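/- Let $k$ be a field and $\mathfrak a$ a $k$-linear category with composition $m$. For a $k$-linear category let $Z^2\mathbf C(\mathfrak a)$ be the space of Hochschild 2-cocycles (bilinear $\phi=(\phi:\mathfrak a(B,C)\times\mathfrak a(A,B)\to\mathfrak a(A,C))$ with $\phi(f,g)h-\phi(f,gh)+\phi(fg,h)-f\phi(g,h)=0$), $HH^2(\mathfrak a)$ its quotient by the coboundaries, and for $\phi\in Z^2\mathbf C(\mathfrak a)$ let $\mathfrak a_\phi[\epsilon]=(k[\epsilon]\otimes\mathfrak a,\,m+\phi\epsilon)$ be the corresponding linear deformation ($\epsilon^2=0$). A *precomplex* over $\mathfrak a$ is a $\mathbb Z$-graded object $C$ with a degree $1$ graded endomorphism $\delta_C$. Precomplexes form a cdg category $\mathsf{PCom}(\mathfrak a)$ with $\mathsf{PCom}(\mathfrak a)(C,D)^n=\prod_i\mathfrak a(C^i,D^{i+n})$, the evident composition, $d(f)=\delta f-(-1)^{|f|}f\delta$ and curvature $c_C=-\delta_C^2$; $\mathsf{Com}^+(\mathfrak a)\subset\mathsf{PCom}(\mathfrak a)$ is the full dg subcategory of bounded below complexes. Put $\mathrm{embr}_\delta(\phi)=\phi+\phi\{\delta\}+\phi\{\delta,\delta\}$,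 a Hochschild 2-cocycle of $\mathsf{PCom}(\mathfrak a)$, where $\phi\{\delta\}(f)=\phi(\delta,f)-(-1)^{|f|}\phi(f,\delta)$ and $\phi\{\delta,\delta\}=-\phi(\delta,\delta)$. A *(first order) cdg, resp. dg, deformation* of a cdg, resp. dg, category $(\mathfrak b,\mu)$ is a $k[\epsilon]$-linear cdg, resp. dg, structure on a quiver identified with $k[\epsilon]\otimes_k\mathfrak b$ (same objects) reducing to $\mu$ modulo $\epsilon$. An *isomorphism* of deformations is an $A_{[0,\infty[}$-isomorphism with fixed objects (components $F_n:(\Sigma-)^{\otimes n}\to\Sigma-$, $n\ge 0$, with $F_0$ allowed to be nonzero) that reduces to the identity modulo $\epsilon$. A *partial* dg deformation of $\mathfrak b$ is a dg deformation of a full subcategory of $\mathfrak b$; a *morphism* of partial deformations is an isomorphism of deformations onto a full subcategory; a partial deformation is *maximal* if every morphism out of it is an isomorphism. $\mathrm{Sk}$ denotes isomorphism classes, and $\text{dg-pDef}$, $\text{dg-mpDef}$ the partial, resp. maximal partial, dg deformations. Let $R(\phi)$ be the cdg deformation $(k[\epsilon]\otimes\mathsf{PCom}(\mathfrak a),\,\mu+\mathrm{embr}_\delta(\phi)\epsilon)$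 of $(\mathsf{PCom}(\mathfrak a),\mu)$. Let $\mathsf{Com}^+(\mathfrak a)_{\phi-\infty}\subset\mathsf{Com}^+(\mathfrak a)$ be the full subcategory of those $C$ for which the class of $-\phi(\delta_C,\delta_C)$ in $H^2(\mathsf{Com}^+(\mathfrak a)(C,C))$ is zero. Let $\rho':HH^2(\mathfrak a)\to\mathrm{Sk}(\text{dg-pDef}_{\mathsf{Com}^+(\mathfrak a)}(k[\epsilon]))$ send $[\phi]$ to the class of the dg deformation of $\mathsf{Com}^+(\mathfrak a)_{\phi-\infty}$ given by $\mathrm{embr}_\delta(\phi)+d_{\mathrm{Hoch}}(h)$, where $h=(h_C)_C$ with $h_C\in\mathsf{Com}^+(\mathfrak a)(C,C)^1$ is any choice making the arity $0$ part of this cocycle zero. **Theorem.** Let $\phi\in Z^2\mathbf C(\mathfrak a)$. 1. $R(\phi)$ coincides, under the canonical identification of quivers (hence is isomorphic as a cdg deformation), with the full subcategory of $\mathsf{PCom}(\mathfrak a_\phi[\epsilon])$ on the trivial precomplexes $k[\epsilon]\otimes_kC$, $C\in\mathsf{PCom}(\mathfrak a)$. 2. For every collection $\Gamma=\{\bar C\}_{C\in\mathsf{PCom}(\mathfrak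 a)}$ of precomplexes over $\mathfrak a_\phi[\epsilon]$ with $k\otimes_{k[\epsilon]}\bar C=C$, the full subcategory of $\mathsf{PCom}(\mathfrak a_\phi[\epsilon])$ spanned by $\Gamma$ is a cdg deformation of $\mathsf{PCom}(\mathfrak a)$ isomorphic to $R(\phi)$. 3. For every collection $\Gamma=\{\bar C\}_{C\in\mathsf{Com}^+(\mathfrak a)_{\phi-\infty}}$ of complexes over $\mathfrak a_\phi[\epsilon]$ with $k\otimes_{k[\epsilon]}\bar C=C$, the full subcategory of $\mathsf{Com}^+(\mathfrak a_\phi[\epsilon])$ spanned by $\Gamma$ is a maximal partial dg deformation of $\mathsf{Com}^+(\mathfrak a)$ representing $\rho'([\phi])$. Consequently $\rho'$ factors through a map $\rho:HH^2(\mathfrak a)\to\mathrm{Sk}(\text{dg-mpDef}_{\mathsf{Com}^+(\mathfrak a)}(k[\epsilon]))$. If $\mathfrak a$ has a zero object, so that $\mathfrak a\subset\mathsf{Com}^+(\mathfrak a)$ as the complexes concentrated in degree $0$, then $\rho$ is injective, and its image consists of the classes of those maximal partial dg deformations that are dg deformations of some full subcategory $\mathfrak a'$ with $\mathfrak a\subset\mathfrak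 a'\subset\mathsf{Com}^+(\mathfrak a)$. -/

import Mathlib

open CategoryTheory

universe w v u u'

namespace LowenDef

/-! ## First order extension of modules -/

/-- The `k[ε]`-module `k[ε] ⊗ M = M ⊕ Mε`; the pair `(x, y)` stands for `x + yε`. -/
@[ext]
structure Eps (M : Type v) where
  re : M
  im : M

namespace Eps

/-- `x + yε` as a pair, used to transfer the additive structure. -/
def toProd {M : Type v} (x : Eps M) : M × M := (x.re, x.im)

theorem toProd_injective {M : Type v} : Function.Injective (toProd (M := M)) := by
  intro x y h
  simp only [toProd, Prod.mk.injEq] at h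
  exact Eps.ext h.1 h.2

variable {k : Type w} [CommRing k] {M : Type v} [AddCommGroup M]

instance : Zero (Eps M) := ⟨⟨0, 0⟩⟩
instance : Add (Eps M) := ⟨fun x y => ⟨x.re + y.re, x.im + y.im⟩⟩
instance : Neg (Eps M) := ⟨fun x => ⟨-x.re, -x.im⟩⟩
instance : Sub (Eps M) := ⟨fun x y => ⟨x.re - y.re, x.im - y.im⟩⟩
instance : SMul ℕ (Eps M) := ⟨fun n x => ⟨n • x.re, n • x.im⟩⟩
instance : SMul ℤ (Eps M) := ⟨fun n x => ⟨n • x.re, n • x.im⟩⟩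

instance : AddCommGroup (Eps M) :=
  toProd_injective.addCommGroup toProd rfl (fun _ _ => rfl) (fun _ => rfl) (fun _ _ => rfl)
    (fun _ _ => rfl) (fun _ _ => rfl)

@[simp] theorem re_zero : (0 : Eps M).re = 0 := rfl
@[simp] theorem im_zero : (0 : Eps M).im = 0 := rfl
@[simp] theorem re_add (x y : Eps M) : (x + y).re = x.re + y.re := rfl
@[simp] theorem im_add (x y : Eps M) : (x + y).im = x.im + y.im := rfl
@[simp] theorem re_neg (x : Eps M) : (-x).re = -x.re := rfl
@[simp] theorem im_neg (x : Eps M) : (-x).im = -x.im := rfl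
@[simp] theorem re_sub (x y : Eps M) : (x - y).re = x.re - y.re := rfl
@[simp] theorem im_sub (x y : Eps M) : (x - y).im = x.im - y.im := rfl
@[simp] theorem re_zsmul (n : ℤ) (x : Eps M) : (n • x).re = n • x.re := rfl
@[simp] theorem im_zsmul (n : ℤ) (x : Eps M) : (n • x).im = n • x.im := rfl
@[simp] theorem re_usmul (n : ℤˣ) (x : Eps M) : (n • x).re = n • x.re := rfl
@[simp] theorem im_usmul (n : ℤˣ) (x : Eps M) : (n • x).im = n • x.im := rfl

variable [Module k M]

/-- `(r + sε)(x + yε) = rx + (ry + sx)ε`. -/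
instance : SMul (DualNumber k) (Eps M) :=
  ⟨fun r x => ⟨r.fst • x.re, r.fst • x.im + r.snd • x.re⟩⟩

@[simp] theorem re_smul (r : DualNumber k) (x : Eps M) : (r • x).re = r.fst • x.re := rfl
@[simp] theorem im_smul (r : DualNumber k) (x : Eps M) :
    (r • x).im = r.fst • x.im + r.snd • x.re := rfl

instance : Module (DualNumber k) (Eps M) where
  one_smul x := by ext <;> simp
  mul_smul r s x := by
    ext
    · simp [mul_smul]
    · simp only [re_smul, im_smul, TrivSqZeroExt.fst_mul, TrivSqZeroExt.snd_mul, smul_eq_mul,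
        MulOpposite.smul_eq_mul_unop, MulOpposite.unop_op, add_smul, mul_smul, smul_add]
      rw [add_assoc]
  smul_zero r := by ext <;> simp
  smul_add r x y := by
    ext
    · simp
    · simp only [im_smul, im_add, re_add, smul_add]; abel
  add_smul r s x := by
    ext
    · simp [add_smul]
    · simp only [im_smul, im_add, TrivSqZeroExt.fst_add, TrivSqZeroExt.snd_add, add_smul]; abel
  zero_smul x := by ext <;> simp

end Eps

/-! ## Graded quivers and cdg structures -/

/-- A graded `R`-quiver with set of objects `T`. -/
structure GrQuiver (R : Type w) [CommRing R] (T : Type u) where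
  Hom : T → T → ℤ → Type v
  [acg : ∀ A B n, AddCommGroup (Hom A B n)]
  [mod : ∀ A B n, Module R (Hom A B n)]

attribute [instance] GrQuiver.acg GrQuiver.mod

section Quivers

variable {R : Type w} [CommRing R] {T : Type u}

/-- The quiver with objects `T'` induced along a map `o` on objects. For `o` the inclusion of a
subset this is the full subquiver on that subset. -/
def GrQuiver.pull {T' : Type*} (Q : GrQuiver.{w, v} R T) (o : T' → T) : GrQuiver.{w, v} R T' where
  Hom A B n := Q.Hom (o A) (o B) n

/-- A Hochschild cochain of Hochschild degree `2` on a graded quiver with components in arity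
at most `2`: a degree `0` component `m` of arity `2`, a degree `1` component `d` of arity `1` and a
degree `2` component `c` of arity `0`. Here `m f g` is written for `f : B → C` and `g : A → B`. -/
structure Cochain2 (Q : GrQuiver.{w, v} R T) where
  m : ∀ {A B C : T} {p q n : ℤ}, p + q = n →
    (Q.Hom B C p →ₗ[R] Q.Hom A B q →ₗ[R] Q.Hom A C n)
  d : ∀ {A B : T} {p q : ℤ}, p + 1 = q → (Q.Hom A B p →ₗ[R] Q.Hom A B q)
  c : ∀ A : T, Q.Hom A A 2

/-- The cochain `(m, d, c)` is a cdg structure. -/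
structure Cochain2.IsCDG {Q : GrQuiver.{w, v} R T} (μ : Cochain2 Q) : Prop where
  d_c : ∀ A : T, μ.d (show (2 : ℤ) + 1 = 3 by norm_num) (μ.c A) = 0
  d_d : ∀ {A B : T} {p q r : ℤ} (h : p + 1 = q) (h' : q + 1 = r) (f : Q.Hom A B p),
    μ.d h' (μ.d h f) =
      -(μ.m (show 2 + p = r by omega) (μ.c B) f - μ.m (show p + 2 = r by omega) f (μ.c A))
  leibniz : ∀ {A B C : T} {p q n p' q' n' : ℤ} (h : p + q = n) (hp : p + 1 = p') (hq : q + 1 = q')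
    (hn : n + 1 = n') (f : Q.Hom B C p) (g : Q.Hom A B q),
    μ.d hn (μ.m h f g) =
      μ.m (show p' + q = n' by omega) (μ.d hp f) g +
        p.negOnePow • μ.m (show p + q' = n' by omega) f (μ.d hq g)
  assoc : ∀ {A B C D : T} {p q r pq qr n : ℤ} (hpq : p + q = pq) (hqr : q + r = qr)
    (h : p + q + r = n) (f : Q.Hom C D p) (g : Q.Hom B C q) (e : Q.Hom A B r),
    μ.m (show pq + r = n by omega) (μ.m hpq f g) e =
      μ.m (show p + qr = n by omega) f (μ.m hqr g e)

/-- Restriction of a cochain along a map on objects. -/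
def Cochain2.pull {T' : Type*} {Q : GrQuiver.{w, v} R T} (μ : Cochain2 Q) (o : T' → T) :
    Cochain2 (Q.pull o) where
  m h := μ.m h
  d h := μ.d h
  c A := μ.c (o A)

instance {Q : GrQuiver.{w, v} R T} : Add (Cochain2 Q) :=
  ⟨fun μ ν => ⟨fun h => μ.m h + ν.m h, fun h => μ.d h + ν.d h, fun A => μ.c A + ν.c A⟩⟩

/-- For a cdg structure `μ`, the Hochschild coboundary of a cochain `h` of arity `0` and degree `1`,
that is `h ∈ ∏_A Q(A,A)^1`. Its component of arity `1` is `f ↦ h f - (-1)^|f| f h` and its component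
of arity `0` is `-d(h)`. -/
def Cochain2.coboundaryZero {Q : GrQuiver.{w, v} R T} (μ : Cochain2 Q) (h : ∀ A : T, Q.Hom A A 1) :
    Cochain2 Q where
  m _ := 0
  d {A B p q} hpq :=
    μ.m (show 1 + p = q by omega) (h B) - p.negOnePow • (μ.m hpq).flip (h A)
  c A := -μ.d (show (1 : ℤ) + 1 = 2 by norm_num) (h A)

theorem Cochain2.IsCDG.pull {T' : Type*} {Q : GrQuiver.{w, v} R T} {μ : Cochain2 Q}
    (hμ : μ.IsCDG) (o : T' → T) : (μ.pull o).IsCDG where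
  d_c A := hμ.d_c (o A)
  d_d h h' f := hμ.d_d h h' f
  leibniz h hp hq hn f g := hμ.leibniz h hp hq hn f g
  assoc hpq hqr h f g e := hμ.assoc hpq hqr h f g e

/-- A cdg structure may be transported along linear isomorphisms of the graded modules of
morphisms. -/
theorem Cochain2.IsCDG.transfer {Q Q' : GrQuiver.{w, v} R T} {μ : Cochain2 Q} {μ' : Cochain2 Q'}
    (hμ : μ.IsCDG) (e : ∀ (A B : T) (n : ℤ), Q.Hom A B n ≃ₗ[R] Q'.Hom A B n)
    (em : ∀ {A B C : T} {p q n : ℤ} (h : p + q = n) (f : Q.Hom B C p) (g : Q.Hom A B q),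
      e A C n (μ.m h f g) = μ'.m h (e B C p f) (e A B q g))
    (ed : ∀ {A B : T} {p q : ℤ} (h : p + 1 = q) (f : Q.Hom A B p),
      e A B q (μ.d h f) = μ'.d h (e A B p f))
    (ec : ∀ A : T, e A A 2 (μ.c A) = μ'.c A) : μ'.IsCDG where
  d_c A := by rw [← ec, ← ed, hμ.d_c, map_zero]
  d_d {A B p q r} h h' f := by
    obtain ⟨f, rfl⟩ := (e _ _ _).surjective f
    rw [← ed, ← ed, hμ.d_d h h', ← ec, ← ec, ← em, ← em, map_neg, map_sub]
  leibniz h hp hq hn f g := by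
    obtain ⟨f, rfl⟩ := (e _ _ _).surjective f
    obtain ⟨g, rfl⟩ := (e _ _ _).surjective g
    rw [← em, ← ed, hμ.leibniz h hp hq hn, ← ed, ← ed, ← em, ← em, map_add, Units.smul_def,
      map_zsmul, Units.smul_def]
  assoc hpq hqr h f g i := by
    obtain ⟨f, rfl⟩ := (e _ _ _).surjective f
    obtain ⟨g, rfl⟩ := (e _ _ _).surjective g
    obtain ⟨i, rfl⟩ := (e _ _ _).surjective i
    rw [← em, ← em, hμ.assoc hpq hqr h, ← em, ← em]

/-! ## Morphisms with fixed objects -/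

/-- Composable sequences `(f_n, …, f_1)` of homogeneous elements, from the source of `f_1` to the
target of `f_n`. -/
inductive Path (Q : GrQuiver.{w, v} R T) : T → T → Type (max u v)
  | nil (A : T) : Path Q A A
  | cons {A B C : T} {n : ℤ} (f : Q.Hom B C n) (p : Path Q A B) : Path Q A C

namespace Path

variable {Q : GrQuiver.{w, v} R T}

/-- Concatenation. -/
def append {A B : T} : ∀ {C : T}, Path Q B C → Path Q A B → Path Q A C
  | _, nil _, q => q
  | _, cons f p, q => cons f (append p q)

/-- The degree of `σf_n ⊗ ⋯ ⊗ σf_1` in `(Σ Q)^{⊗ n}`, namely `∑ (|f_i| - 1)`. -/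
def sdeg : ∀ {A B : T}, Path Q A B → ℤ
  | _, _, nil _ => 0
  | _, _, cons (n := n) _ p => (n - 1) + sdeg p

/-- The sum of `Φ (f_n, …, f_{i+1}) (f_i, …, f_1)` over `0 ≤ i ≤ n`. -/
def sumSplit {M : Type v} [AddCommGroup M] {A : T} : ∀ {C : T}, Path Q A C →
    (∀ B : T, Path Q B C → Path Q A B → M) → M
  | _, nil A, Φ => Φ A (nil A) (nil A)
  | C, cons f p, Φ => Φ C (nil C) (cons f p) + sumSplit p (fun B l r => Φ B (cons f l) r)

/-- Evaluation of `Φ` on `m (f, g_1) ⊗ g_2 ⊗ ⋯` with the sign coming from the shift; zero if there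
is no first element `g_1`. -/
def contractFirst (μ : Cochain2 Q) {M : Type v} [AddCommGroup M] {B C : T} {n : ℤ}
    (f : Q.Hom B C n) : ∀ {A : T}, Path Q A B → (Path Q A C → M) → M
  | _, nil _, _ => 0
  | _, cons g p, Φ => n.negOnePow • Φ (cons (μ.m rfl f g) p)

/-- The evaluation of `Φ` on `∑ (1 ⊗ ⋯ ⊗ b ⊗ ⋯ ⊗ 1)(σf_n, …, σf_1)`, where
`b_0 = σc`, `b_1(σf) = -σ d(f)` and `b_2(σf, σg) = (-1)^|f| σ m(f, g)` are the coefficients of the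
degree `1` element `b` corresponding to `μ = (m, d, c)`, and the Koszul sign rule is used. -/
def sumInsert (μ : Cochain2 Q) {M : Type v} [AddCommGroup M] {A : T} : ∀ {C : T}, Path Q A C →
    (Path Q A C → M) → M
  | _, nil A, Φ => Φ (cons (μ.c A) (nil A))
  | C, cons (n := n) f p, Φ =>
      Φ (cons (μ.c C) (cons f p)) - Φ (cons (μ.d rfl f) p) + contractFirst μ f p Φ +
        (n - 1).negOnePow • sumInsert μ p (fun q => Φ (cons f q))

end Path

/-- A morphism of `A_{[0,∞[}`-categories with fixed objects between two cdg categories. The value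
`F (f_n, …, f_1)` is `σ^{-1} F_n(σf_n, …, σf_1)`, where `F_n : (ΣQ)^{⊗ n} → ΣQ'` has degree `0`;
`F p e` is its component of degree `e`, which is zero for `e ≠ ∑ (|f_i| - 1) + 1`.
The last two fields express `b' ∘ F = F ∘ b`, for the coefficients `b`, `b'` corresponding to
`μ`, `μ'`, on the empty sequences and on the nonempty sequences, respectively. -/
structure AMor {Q Q' : GrQuiver.{w, v} R T} (μ : Cochain2 Q) (μ' : Cochain2 Q') where
  F : ∀ {A B : T}, Path Q A B → ∀ e : ℤ, Q'.Hom A B e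
  F_deg : ∀ {A B : T} (p : Path Q A B) (e : ℤ), e ≠ p.sdeg + 1 → F p e = 0
  F_add : ∀ {A B C D : T} {n : ℤ} (l : Path Q C D) (f g : Q.Hom B C n) (r : Path Q A B) (e : ℤ),
    F (l.append (.cons (f + g) r)) e =
      F (l.append (.cons f r)) e + F (l.append (.cons g r)) e
  F_smul : ∀ {A B C D : T} {n : ℤ} (l : Path Q C D) (x : R) (f : Q.Hom B C n) (r : Path Q A B)
    (e : ℤ), F (l.append (.cons (x • f) r)) e = x • F (l.append (.cons f r)) e
  eq_nil : ∀ A : T,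
    μ'.c A - μ'.d (show (1 : ℤ) + 1 = 2 by norm_num) (F (.nil A) 1) -
        μ'.m (show (1 : ℤ) + 1 = 2 by norm_num) (F (.nil A) 1) (F (.nil A) 1) =
      F (.cons (μ.c A) (.nil A)) 2
  eq_cons : ∀ {A B C : T} {n : ℤ} (f : Q.Hom B C n) (p : Path Q A B) (i e : ℤ)
    (_ : (Path.cons f p).sdeg + 1 = i) (he : i + 1 = e),
    -μ'.d he (F (.cons f p) i) +
        (Path.cons f p).sumSplit (fun _ l r => (l.sdeg + 1).negOnePow •
          μ'.m (add_sub_cancel (l.sdeg + 1) e) (F l (l.sdeg + 1)) (F r (e - (l.sdeg + 1)))) =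
      (Path.cons f p).sumInsert μ (fun q => F q e)

end Quivers

/-! ## First order deformations -/

section Deformations

variable {k : Type w} [CommRing k] {T : Type u}

/-- The `k[ε]`-quiver `k[ε] ⊗ Q`. -/
def GrQuiver.eps (Q : GrQuiver.{w, v} k T) : GrQuiver.{w, v} (DualNumber k) T where
  Hom A B n := Eps (Q.Hom A B n)

/-- The `k[ε]`-linear extension `x + yε ↦ f(x) + (f(y) + g(x))ε` of `f + gε`. -/
def epsLin {M N : Type v} [AddCommGroup M] [AddCommGroup N] [Module k M] [Module k N]
    (f g : M →ₗ[k] N) : Eps M →ₗ[DualNumber k] Eps N where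
  toFun x := ⟨f x.re, f x.im + g x.re⟩
  map_add' x y := by ext <;> simp [add_add_add_comm]
  map_smul' r x := by
    ext
    · simp
    · simp only [Eps.re_smul, Eps.im_smul, map_add, map_smul, RingHom.id_apply, smul_add]
      abel

/-- The `k[ε]`-bilinear extension of `f + gε`. -/
def epsBilin {M N P : Type v} [AddCommGroup M] [AddCommGroup N] [AddCommGroup P]
    [Module k M] [Module k N] [Module k P] (f g : M →ₗ[k] N →ₗ[k] P) :
    Eps M →ₗ[DualNumber k] Eps N →ₗ[DualNumber k] Eps P :=
  LinearMap.mk₂ (DualNumber k)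
    (fun x y => ⟨f x.re y.re, f x.re y.im + f x.im y.re + g x.re y.re⟩)
    (fun x x' y => by
      ext
      · simp
      · simp only [Eps.re_add, Eps.im_add, map_add, LinearMap.add_apply]; abel)
    (fun r x y => by
      ext
      · simp
      · simp only [Eps.re_smul, Eps.im_smul, map_add, map_smul, LinearMap.add_apply,
          LinearMap.smul_apply, smul_add]; abel)
    (fun x y y' => by
      ext
      · simp
      · simp only [Eps.re_add, Eps.im_add, map_add]; abel)
    (fun r x y => by
      ext
      · simp
      · simp only [Eps.re_smul, Eps.im_smul, map_add, map_smul, smul_add]; abel)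

/-- The cochain `μ + ψε` on `k[ε] ⊗ Q`. -/
def Cochain2.eps {Q : GrQuiver.{w, v} k T} (μ ψ : Cochain2 Q) : Cochain2 Q.eps where
  m h := epsBilin (μ.m h) (ψ.m h)
  d h := epsLin (μ.d h) (ψ.d h)
  c A := ⟨μ.c A, ψ.c A⟩

/-- A first order cdg deformation of the cdg category `(Q, μ)`: a `k[ε]`-linear cdg category
with the same objects on a quiver identified with `k[ε] ⊗ Q`, whose reduction modulo `ε` is `μ`. -/
structure Deformation {Q : GrQuiver.{w, v} k T} (μ : Cochain2 Q) where
  quiv : GrQuiver.{w, v} (DualNumber k) T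
  e : ∀ (A B : T) (n : ℤ), quiv.Hom A B n ≃ₗ[DualNumber k] Eps (Q.Hom A B n)
  str : Cochain2 quiv
  isCDG : str.IsCDG
  red_m : ∀ {A B C : T} {p q n : ℤ} (h : p + q = n) (f : quiv.Hom B C p) (g : quiv.Hom A B q),
    (e A C n (str.m h f g)).re = μ.m h (e B C p f).re (e A B q g).re
  red_d : ∀ {A B : T} {p q : ℤ} (h : p + 1 = q) (f : quiv.Hom A B p),
    (e A B q (str.d h f)).re = μ.d h (e A B p f).re
  red_c : ∀ A : T, (e A A 2 (str.c A)).re = μ.c A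

namespace Deformation

variable {Q : GrQuiver.{w, v} k T} {μ : Cochain2 Q}

/-- A cdg deformation is a dg deformation if its curvature vanishes. -/
def IsDG (D : Deformation μ) : Prop := ∀ A : T, D.str.c A = 0

/-- Two deformations are isomorphic if there is an `A_{[0,∞[}`-morphism `F` between them whose
reduction modulo `ε` is the identity morphism (the arity `1` part of which is the identity and the
other parts of which are zero). As `ε² = 0`, such an `F = 1 + hε` is invertible with inverse
`1 - hε`. -/
def Iso (D D' : Deformation μ) : Prop :=
  ∃ F : AMor D.str D'.str,
    (∀ (A : T) (i : ℤ), (D'.e A A i (F.F (.nil A) i)).re = 0) ∧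
    (∀ {A B : T} {n : ℤ} (f : D.quiv.Hom A B n),
      (D'.e A B n (F.F (.cons f (.nil A)) n)).re = (D.e A B n f).re) ∧
    (∀ {A B C E : T} {n n' : ℤ} (f : D.quiv.Hom C E n) (g : D.quiv.Hom B C n')
      (p : Path D.quiv A B) (i : ℤ), (D'.e A E i (F.F (.cons f (.cons g p)) i)).re = 0)

/-- Two deformations coincide if their structures are equal once both quivers are identified with
`k[ε] ⊗ Q`. -/
def Coincide (D D' : Deformation μ) : Prop :=
  (∀ {A B C : T} {p q n : ℤ} (h : p + q = n) (f : Eps (Q.Hom B C p)) (g : Eps (Q.Hom A B q)),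
    D.e A C n (D.str.m h ((D.e B C p).symm f) ((D.e A B q).symm g)) =
      D'.e A C n (D'.str.m h ((D'.e B C p).symm f) ((D'.e A B q).symm g))) ∧
  (∀ {A B : T} {p q : ℤ} (h : p + 1 = q) (f : Eps (Q.Hom A B p)),
    D.e A B q (D.str.d h ((D.e A B p).symm f)) =
      D'.e A B q (D'.str.d h ((D'.e A B p).symm f))) ∧
  (∀ A : T, D.e A A 2 (D.str.c A) = D'.e A A 2 (D'.str.c A))

/-- The induced deformation along a map on objects. -/
def pull {T' : Type*} (D : Deformation μ) (o : T' → T) : Deformation (μ.pull o) where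
  quiv := D.quiv.pull o
  e A B n := D.e (o A) (o B) n
  str := D.str.pull o
  isCDG := D.isCDG.pull o
  red_m h f g := D.red_m h f g
  red_d h f := D.red_d h f
  red_c A := D.red_c (o A)

end Deformation

/-- A partial first order dg deformation of `(Q, μ)`: a first order dg deformation of the full
subcategory on a set `S` of objects. -/
structure PartialDG {Q : GrQuiver.{w, v} k T} (μ : Cochain2 Q) where
  S : Set T
  D : Deformation (μ.pull (Subtype.val : S → T))
  isDG : D.IsDG

namespace PartialDG

variable {Q : GrQuiver.{w, v} k T} {μ : Cochain2 Q}

/-- The full subcategory of a deformation of the full subcategory on `P.S`, on a smaller set of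
objects. -/
def restrict (P : PartialDG μ) {S : Set T} (h : S ⊆ P.S) :
    Deformation (μ.pull (Subtype.val : S → T)) :=
  P.D.pull (Set.inclusion h)

/-- There is a morphism `P → P'` of partial deformations: `P` is isomorphic, as a deformation, to a
full subcategory of `P'`. -/
def HasMor (P P' : PartialDG μ) : Prop :=
  ∃ h : P.S ⊆ P'.S, P.D.Iso (P'.restrict h)

/-- `P` and `P'` are isomorphic partial deformations: they are deformations of the same full
subcategory and as such isomorphic. -/
def Iso (P P' : PartialDG μ) : Prop :=
  ∃ h : P.S = P'.S, P.D.Iso (P'.restrict h.subset)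

/-- `P` is maximal if every morphism `P → P'` of partial deformations is an isomorphism; as the
morphisms are isomorphisms onto full subcategories, this says that `P'` has no more objects. -/
def IsMaximal (P : PartialDG μ) : Prop :=
  ∀ P' : PartialDG μ, P.HasMor P' → P'.S = P.S

variable (μ)

/-- Isomorphism classes of partial dg deformations. -/
def Sk : Type _ := Quot (PartialDG.Iso (μ := μ))

/-- Isomorphism classes of maximal partial dg deformations. -/
def SkMax : Type _ :=
  Quot (fun P P' : {P : PartialDG μ // P.IsMaximal} => PartialDG.Iso P.1 P'.1)

variable {μ}

/-- The isomorphism class of a partial dg deformation. -/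
def Sk.mk (P : PartialDG μ) : Sk μ := Quot.mk _ P

/-- The isomorphism class of a maximal partial dg deformation. -/
def SkMax.mk (P : PartialDG μ) (hP : P.IsMaximal) : SkMax μ := Quot.mk _ ⟨P, hP⟩

/-- The isomorphism class of a maximal partial dg deformation, as a partial dg deformation. -/
def SkMax.forget : SkMax μ → Sk μ := Quot.map Subtype.val (fun _ _ h => h)

end PartialDG

end Deformations

/-! ## Linear categories, Hochschild 2-cocycles and linear deformations -/

section Linear

variable (R : Type w) [CommRing R] (a : Type u) [Category.{v} a] [Preadditive a] [Linear R a]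

/-- Hochschild `1`-cochains of a linear category. -/
def C1 : Type (max u v) := ∀ A B : a, (A ⟶ B) →ₗ[R] (A ⟶ B)

/-- Hochschild `2`-cochains of a linear category; `φ A B C f g` is `φ(f, g)` for
`f : B → C` and `g : A → B`. -/
def C2 : Type (max u v) := ∀ A B C : a, (B ⟶ C) →ₗ[R] (A ⟶ B) →ₗ[R] (A ⟶ C)

instance : AddCommGroup (C1 R a) :=
  inferInstanceAs (AddCommGroup (∀ A B : a, (A ⟶ B) →ₗ[R] (A ⟶ B)))

instance : Module R (C1 R a) :=
  inferInstanceAs (Module R (∀ A B : a, (A ⟶ B) →ₗ[R] (A ⟶ B)))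

instance : AddCommGroup (C2 R a) :=
  inferInstanceAs (AddCommGroup (∀ A B C : a, (B ⟶ C) →ₗ[R] (A ⟶ B) →ₗ[R] (A ⟶ C)))

instance : Module R (C2 R a) :=
  inferInstanceAs (Module R (∀ A B C : a, (B ⟶ C) →ₗ[R] (A ⟶ B) →ₗ[R] (A ⟶ C)))

section

variable {R a}

theorem C2.ext {φ ψ : C2 R a}
    (h : ∀ (A B C : a) (f : B ⟶ C) (g : A ⟶ B), φ A B C f g = ψ A B C f g) : φ = ψ :=
  funext fun A => funext fun B => funext fun C => LinearMap.ext₂ (h A B C)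

@[simp] theorem C1.add_apply (h h' : C1 R a) (A B : a) (f : A ⟶ B) :
    (h + h') A B f = h A B f + h' A B f := rfl
@[simp] theorem C1.smul_apply (r : R) (h : C1 R a) (A B : a) (f : A ⟶ B) :
    (r • h) A B f = r • h A B f := rfl
@[simp] theorem C2.zero_apply (A B C : a) (f : B ⟶ C) (g : A ⟶ B) :
    (0 : C2 R a) A B C f g = 0 := rfl
@[simp] theorem C2.add_apply (φ ψ : C2 R a) (A B C : a) (f : B ⟶ C) (g : A ⟶ B) :
    (φ + ψ) A B C f g = φ A B C f g + ψ A B C f g := rfl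
@[simp] theorem C2.smul_apply (r : R) (φ : C2 R a) (A B C : a) (f : B ⟶ C) (g : A ⟶ B) :
    (r • φ) A B C f g = r • φ A B C f g := rfl

end

/-- The composition `m(f, g) = f g = g ≫ f` as a `2`-cochain. -/
def compC2 : C2 R a := fun A B C => (Linear.comp A B C).flip

variable {R a}

/-- A bilinear multiplication is associative. -/
def C2.IsAssoc (φ : C2 R a) : Prop :=
  ∀ {A B C D : a} (f : C ⟶ D) (g : B ⟶ C) (h : A ⟶ B),
    φ A B D (φ B C D f g) h = φ A C D f (φ A B C g h)

theorem compC2_isAssoc : (compC2 R a).IsAssoc := by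
  intro A B C D f g h
  simp [compC2, Linear.comp]

variable (R a)

variable {R a} in
/-- `(dh)(f, g) = h(f) g - h(f g) + f h(g)`. -/
def d1Fun (h : C1 R a) : C2 R a := fun A B C => LinearMap.mk₂ R
  (fun f g => g ≫ h B C f - h A C (g ≫ f) + h A B g ≫ f)
  (fun f f' g => by simp only [map_add, Preadditive.comp_add]; abel)
  (fun r f g => by simp [smul_sub, smul_add])
  (fun f g g' => by simp only [map_add, Preadditive.add_comp]; abel)
  (fun r f g => by simp [smul_sub, smul_add])

variable {R a} in
theorem d1Fun_apply (h : C1 R a) {A B C : a} (f : B ⟶ C) (g : A ⟶ B) :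
    d1Fun h A B C f g = g ≫ h B C f - h A C (g ≫ f) + h A B g ≫ f := rfl

/-- The Hochschild differential `C¹ → C²`. -/
def d1 : C1 R a →ₗ[R] C2 R a where
  toFun := d1Fun
  map_add' h h' := C2.ext fun A B C f g => by
    simp only [C2.add_apply, d1Fun_apply, C1.add_apply, Preadditive.comp_add,
      Preadditive.add_comp]
    abel
  map_smul' r h := C2.ext fun A B C f g => by
    simp only [C2.smul_apply, d1Fun_apply, C1.smul_apply, Linear.comp_smul,
      Linear.smul_comp, smul_sub, smul_add, RingHom.id_apply]

/-- Hochschild `2`-cocycles: `φ(f, g) h - φ(f, g h) + φ(f g, h) - f φ(g, h) = 0`. -/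
def Z2 : Submodule R (C2 R a) where
  carrier := {φ | ∀ {A B C D : a} (f : C ⟶ D) (g : B ⟶ C) (h : A ⟶ B),
    h ≫ φ B C D f g - φ A C D f (h ≫ g) + φ A B D (g ≫ f) h - φ A B C g h ≫ f = 0}
  add_mem' := by
    intro φ ψ hφ hψ A B C D f g h
    have h1 := hφ f g h
    have h2 := hψ f g h
    simp only [C2.add_apply, Preadditive.comp_add, Preadditive.add_comp]
    rw [← add_zero (0 : A ⟶ D)]
    nth_rewrite 1 [← h1]
    rw [← h2]
    abel
  zero_mem' := by intro A B C D f g h; simp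
  smul_mem' := by
    intro r φ hφ A B C D f g h
    have h1 := hφ f g h
    simp only [C2.smul_apply, Linear.comp_smul, Linear.smul_comp]
    rw [← smul_sub, ← smul_add, ← smul_sub, h1, smul_zero]

/-- The second Hochschild cohomology of a linear category. -/
abbrev HH2 : Type (max u v) := Z2 R a ⧸ (LinearMap.range (d1 R a)).submoduleOf (Z2 R a)

variable {R a}

/-- The class of a cocycle. -/
def HH2.mk (φ : Z2 R a) : HH2 R a := Submodule.Quotient.mk φ

theorem z2_eq (φ : Z2 R a) {A B C D : a} (f : C ⟶ D) (g : B ⟶ C) (h : A ⟶ B) :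
    h ≫ φ.1 B C D f g - φ.1 A C D f (h ≫ g) + φ.1 A B D (g ≫ f) h - φ.1 A B C g h ≫ f = 0 :=
  φ.2 f g h

/-- The linear deformation `a_φ[ε] = (k[ε] ⊗ a, m + φε)`: it has the objects of `a`. -/
def DefCat (_ : Z2 R a) : Type u := a

namespace DefCat

/-- The underlying object of `a`. -/
def base {φ : Z2 R a} (A : DefCat φ) : a := A

variable (φ : Z2 R a)

theorem unit_left {A B : a} (f : A ⟶ B) :
    φ.1 A B B (𝟙 B) f = f ≫ φ.1 B B B (𝟙 B) (𝟙 B) := by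
  have h := z2_eq φ (𝟙 B) (𝟙 B) f
  simp only [Category.comp_id] at h
  rw [sub_add_cancel, sub_eq_zero] at h
  exact h.symm

theorem unit_right {A B : a} (f : A ⟶ B) :
    φ.1 A A B f (𝟙 A) = φ.1 A A A (𝟙 A) (𝟙 A) ≫ f := by
  have h := z2_eq φ f (𝟙 A) (𝟙 A)
  simp only [Category.id_comp] at h
  rw [sub_self, zero_add, sub_eq_zero] at h
  exact h

/-- The composition is `m + φε`; the identity of `A` is `1 - φ(1, 1)ε`. -/
instance : Category.{v} (DefCat φ) where
  Hom A B := Eps (A.base ⟶ B.base)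
  id A := ⟨𝟙 A.base, -φ.1 A.base A.base A.base (𝟙 A.base) (𝟙 A.base)⟩
  comp {A B C} g f := ⟨g.re ≫ f.re, g.im ≫ f.re + g.re ≫ f.im + φ.1 A.base B.base C.base f.re g.re⟩
  id_comp {A B} f := by
    have := unit_right φ f.re
    ext <;> simp [this]
  comp_id {A B} f := by
    have := unit_left φ f.re
    ext <;> simp [this]
  assoc {A B C D} h g f := by
    ext
    · simp
    · have := z2_eq φ f.re g.re h.re
      simp only [Preadditive.add_comp, Preadditive.comp_add, Category.assoc]
      rw [← sub_eq_zero, ← neg_eq_zero, ← this]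
      abel

instance (A B : DefCat φ) : AddCommGroup (A ⟶ B) :=
  inferInstanceAs (AddCommGroup (Eps (A.base ⟶ B.base)))

instance (A B : DefCat φ) : Module (DualNumber R) (A ⟶ B) :=
  inferInstanceAs (Module (DualNumber R) (Eps (A.base ⟶ B.base)))

variable {φ}

instance : Preadditive (DefCat φ) where
  add_comp A B C g g' f := by
    refine Eps.ext (Preadditive.add_comp _ _ _ g.re g'.re f.re) ?_
    change (g.im + g'.im) ≫ f.re + (g.re + g'.re) ≫ f.im +
        φ.1 A.base B.base C.base f.re (g.re + g'.re) =
      (g.im ≫ f.re + g.re ≫ f.im + φ.1 A.base B.base C.base f.re g.re) +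
        (g'.im ≫ f.re + g'.re ≫ f.im + φ.1 A.base B.base C.base f.re g'.re)
    simp only [Preadditive.add_comp, map_add]
    abel
  comp_add A B C g f f' := by
    refine Eps.ext (Preadditive.comp_add _ _ _ g.re f.re f'.re) ?_
    change g.im ≫ (f.re + f'.re) + g.re ≫ (f.im + f'.im) +
        φ.1 A.base B.base C.base (f.re + f'.re) g.re =
      (g.im ≫ f.re + g.re ≫ f.im + φ.1 A.base B.base C.base f.re g.re) +
        (g.im ≫ f'.re + g.re ≫ f'.im + φ.1 A.base B.base C.base f'.re g.re)
    simp only [Preadditive.comp_add, map_add, LinearMap.add_apply]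
    abel

instance : Linear (DualNumber R) (DefCat φ) where
  smul_comp A B C r g f := by
    refine Eps.ext (Linear.smul_comp _ _ _ r.fst g.re f.re) ?_
    change (r.fst • g.im + r.snd • g.re) ≫ f.re + (r.fst • g.re) ≫ f.im +
        φ.1 A.base B.base C.base f.re (r.fst • g.re) =
      r.fst • (g.im ≫ f.re + g.re ≫ f.im + φ.1 A.base B.base C.base f.re g.re) +
        r.snd • (g.re ≫ f.re)
    simp only [Preadditive.add_comp, Linear.smul_comp, map_smul, smul_add]
    abel
  comp_smul A B C g r f := by
    refine Eps.ext (Linear.comp_smul _ _ _ g.re r.fst f.re) ?_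
    change g.im ≫ (r.fst • f.re) + g.re ≫ (r.fst • f.im + r.snd • f.re) +
        φ.1 A.base B.base C.base (r.fst • f.re) g.re =
      r.fst • (g.im ≫ f.re + g.re ≫ f.im + φ.1 A.base B.base C.base f.re g.re) +
        r.snd • (g.re ≫ f.re)
    simp only [Preadditive.comp_add, Linear.comp_smul, map_smul, LinearMap.smul_apply, smul_add]
    abel

end DefCat

end Linear

/-! ## Precomplexes -/

section Precomplexes

variable {R : Type w} [CommRing R]

/-- A triple `(p, q, hpq)` of integers `p`, `q` and a proof of `p + n = q`. -/
abbrev Triplet (n : ℤ) : Type := CochainComplex.HomComplex.Triplet n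

/-- A precomplex: a `ℤ`-graded object together with a graded endomorphism of degree `1`. -/
structure Precomplex (b : Type u) [Category.{v} b] where
  X : ℤ → b
  δ : ∀ t : Triplet 1, X t.p ⟶ X t.q

/-- Graded morphisms of degree `n`, that is, `∏_p b(C^p, D^{p+n})`. -/
abbrev PHom {b : Type u} [Category.{v} b] (C D : Precomplex b) (n : ℤ) : Type v :=
  ∀ t : Triplet n, C.X t.p ⟶ D.X t.q

variable {b : Type u} [Category.{v} b] [Preadditive b] [Linear R b]

/-- The extension of a `2`-cochain to graded morphisms, `φ(f, g)_p = φ(f_{p + |g|}, g_p)`. -/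
def ext2 (φ : C2 R b) {C D E : Precomplex b} {p q n : ℤ} (h : p + q = n) :
    PHom D E p →ₗ[R] PHom C D q →ₗ[R] PHom C E n :=
  LinearMap.mk₂ R
    (fun f g t => φ _ _ _ (f ⟨t.p + q, t.q, by have := t.hpq; omega⟩) (g ⟨t.p, t.p + q, rfl⟩))
    (fun f f' g => by funext t; simp)
    (fun r f g => by funext t; simp)
    (fun f g g' => by funext t; simp)
    (fun r f g => by funext t; simp)

theorem ext2_apply (φ : C2 R b) {C D E : Precomplex b} {p q n : ℤ} (h : p + q = n)
    (f : PHom D E p) (g : PHom C D q) (i l j : ℤ) (hij : i + n = j) (hl : i + q = l)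
    (hlj : l + p = j) :
    ext2 φ h f g ⟨i, j, hij⟩ = φ _ _ _ (f ⟨l, j, hlj⟩) (g ⟨i, l, hl⟩) := by
  subst hl; rfl

theorem ext2_assoc {φ : C2 R b} (hφ : φ.IsAssoc) {C D E F : Precomplex b} {p q r pq qr n : ℤ}
    (hpq : p + q = pq) (hqr : q + r = qr) (h : pq + r = n) (h' : p + qr = n)
    (f : PHom E F p) (g : PHom D E q) (e : PHom C D r) :
    ext2 φ h (ext2 φ hpq f g) e = ext2 φ h' f (ext2 φ hqr g e) := by
  funext ⟨i, j, hij⟩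
  rw [ext2_apply φ h _ _ i (i + r) j hij rfl (by omega),
    ext2_apply φ hpq _ _ (i + r) (i + r + q) j (by omega) rfl (by omega),
    ext2_apply φ h' _ _ i (i + r + q) j hij (by omega) (by omega),
    ext2_apply φ hqr _ _ i (i + r) (i + r + q) (by omega) rfl rfl, hφ]

variable (R b)

/-- The quiver of precomplexes. -/
def preQuiver : GrQuiver.{w, v} R (Precomplex b) where
  Hom := PHom

variable {R b}

/-- The cochain `embr_δ(φ) = φ + φ{δ} + φ{δ, δ}` on the quiver of precomplexes: its component of
arity `2` is `φ`, its component of arity `1` is `f ↦ φ(δ, f) - (-1)^|f| φ(f, δ)` and its component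
of arity `0` is `-φ(δ, δ)`. -/
def embr (φ : C2 R b) : Cochain2 (preQuiver R b) where
  m h := ext2 φ h
  d {C D p q} h :=
    ext2 φ (show 1 + p = q by omega) D.δ - p.negOnePow • (ext2 φ h).flip C.δ
  c C := -ext2 φ (show (1 : ℤ) + 1 = 2 by norm_num) C.δ C.δ

theorem embr_d (φ : C2 R b) {C D : Precomplex b} {p q : ℤ} (h : p + 1 = q) (f : PHom C D p) :
    (embr φ).d h f =
      ext2 φ (show 1 + p = q by omega) D.δ f - p.negOnePow • ext2 φ h f C.δ := rfl

theorem ext2_ddd {φ : C2 R b} (hφ : φ.IsAssoc) (C : Precomplex b) :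
    ext2 φ (show (1 : ℤ) + 2 = 3 by norm_num) C.δ
        (-ext2 φ (show (1 : ℤ) + 1 = 2 by norm_num) C.δ C.δ) -
      Int.negOnePow 2 • ext2 φ (show (2 : ℤ) + 1 = 3 by norm_num)
        (-ext2 φ (show (1 : ℤ) + 1 = 2 by norm_num) C.δ C.δ) C.δ = 0 := by
  have := ext2_assoc hφ (C := C) (D := C) (E := C) (F := C) (show (1 : ℤ) + 1 = 2 by norm_num)
    (show (1 : ℤ) + 1 = 2 by norm_num) (show (2 : ℤ) + 1 = 3 by norm_num)
    (show (1 : ℤ) + 2 = 3 by norm_num) C.δ C.δ C.δ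
  simp [this, Int.negOnePow_even 2 (by decide)]

theorem ext2_dd {φ : C2 R b} (hφ : φ.IsAssoc) {C D : Precomplex b} {p q r : ℤ} (h : p + 1 = q)
    (h' : q + 1 = r) (f : PHom C D p) :
    ext2 φ (show 1 + q = r by omega) D.δ
        (ext2 φ (show 1 + p = q by omega) D.δ f - p.negOnePow • ext2 φ h f C.δ) -
      q.negOnePow • ext2 φ h'
        (ext2 φ (show 1 + p = q by omega) D.δ f - p.negOnePow • ext2 φ h f C.δ) C.δ =
    -(ext2 φ (show 2 + p = r by omega) (-ext2 φ (show (1 : ℤ) + 1 = 2 by norm_num) D.δ D.δ) f -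
      ext2 φ (show p + 2 = r by omega) f
        (-ext2 φ (show (1 : ℤ) + 1 = 2 by norm_num) C.δ C.δ)) := by
  have e1 := ext2_assoc hφ (show (1 : ℤ) + 1 = 2 by norm_num) (show 1 + p = q by omega)
    (show 2 + p = r by omega) (show 1 + q = r by omega) D.δ D.δ f
  have e2 := ext2_assoc hφ (show 1 + p = q by omega) h (show q + 1 = r by omega)
    (show 1 + q = r by omega) D.δ f C.δ
  have e3 := ext2_assoc hφ h (show (1 : ℤ) + 1 = 2 by norm_num) h'
    (show p + 2 = r by omega) f C.δ C.δ
  subst h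
  rw [Int.negOnePow_succ]
  rcases Int.units_eq_one_or p.negOnePow with hs | hs <;> rw [hs] <;>
    simp [e1, e2, e3] <;> abel

theorem ext2_leibniz {φ : C2 R b} (hφ : φ.IsAssoc) {A B C : Precomplex b} {p q n p' q' n' : ℤ}
    (h : p + q = n) (hp : p + 1 = p') (hq : q + 1 = q') (hn : n + 1 = n')
    (f : PHom B C p) (g : PHom A B q) :
    ext2 φ (show 1 + n = n' by omega) C.δ (ext2 φ h f g) -
        n.negOnePow • ext2 φ hn (ext2 φ h f g) A.δ =
      ext2 φ (show p' + q = n' by omega)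
        (ext2 φ (show 1 + p = p' by omega) C.δ f - p.negOnePow • ext2 φ hp f B.δ) g +
      p.negOnePow • ext2 φ (show p + q' = n' by omega) f
        (ext2 φ (show 1 + q = q' by omega) B.δ g - q.negOnePow • ext2 φ hq g A.δ) := by
  have e1 := ext2_assoc hφ (show 1 + p = p' by omega) h
    (show p' + q = n' by omega) (show 1 + n = n' by omega) C.δ f g
  have e2 := ext2_assoc hφ hp (show 1 + q = q' by omega)
    (show p' + q = n' by omega) (show p + q' = n' by omega) f B.δ g
  have e3 := ext2_assoc hφ h hq hn (show p + q' = n' by omega) f g A.δ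
  subst h
  rw [Int.negOnePow_add]
  rcases Int.units_eq_one_or p.negOnePow with hs | hs <;>
    rcases Int.units_eq_one_or q.negOnePow with ht | ht <;> rw [hs, ht] <;>
    simp [e1, e2, e3] <;> abel

theorem embr_isCDG {φ : C2 R b} (hφ : φ.IsAssoc) : (embr φ).IsCDG where
  d_c C := ext2_ddd hφ C
  d_d h h' f := ext2_dd hφ h h' f
  leibniz h hp hq hn f g := ext2_leibniz hφ h hp hq hn f g
  assoc hpq hqr h f g e := ext2_assoc hφ hpq hqr (by omega) (by omega) f g e

variable (R b)

/-- The cdg category of precomplexes, with `m` the composition, `d(f) = δ f - (-1)^|f| f δ` and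
curvature `c = -δ²`. -/
def pcom : Cochain2 (preQuiver R b) := embr (compC2 R b)

theorem pcom_isCDG : (pcom R b).IsCDG := embr_isCDG compC2_isAssoc

end Precomplexes

/-! ## Precomplexes over a linear deformation -/

section Lifts

variable {k : Type w} [CommRing k] {a : Type u} [Category.{v} a] [Preadditive a] [Linear k a]
variable {φ : Z2 k a}

/-- The reduction `k ⊗_{k[ε]} C` of a precomplex over `a_φ[ε]`. -/
def Precomplex.red (C : Precomplex (DefCat φ)) : Precomplex a where
  X i := (C.X i).base
  δ t := (C.δ t).re

variable (φ) in
/-- The lift `δ + δ'ε` of a precomplex. -/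
def Precomplex.lift (C : Precomplex a) (δ' : PHom C C 1) : Precomplex (DefCat φ) where
  X := C.X
  δ t := ⟨C.δ t, δ' t⟩

variable (φ) in
/-- The trivial precomplex `k[ε] ⊗ C`. -/
def Precomplex.triv (C : Precomplex a) : Precomplex (DefCat φ) := C.lift φ 0

/-- The canonical identification `PCom(a_φ[ε])(C, D)^n ≅ k[ε] ⊗ PCom(a)(k ⊗ C, k ⊗ D)^n`. -/
def redEquiv (C D : Precomplex (DefCat φ)) (n : ℤ) :
    PHom C D n ≃ₗ[DualNumber k] Eps (PHom C.red D.red n) where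
  toFun f := ⟨fun t => (f t).re, fun t => (f t).im⟩
  invFun f := fun t => ⟨f.re t, f.im t⟩
  left_inv _ := rfl
  right_inv _ := rfl
  map_add' _ _ := rfl
  map_smul' _ _ := rfl

/-- The same identification for lifts of given precomplexes. -/
def liftEquiv {C' D' : Precomplex (DefCat φ)} : ∀ {C D : Precomplex a}, C'.red = C → D'.red = D →
    ∀ n : ℤ, PHom C' D' n ≃ₗ[DualNumber k] Eps (PHom C D n)
  | _, _, rfl, rfl, n => redEquiv C' D' n

theorem redEquiv_ext2 {C D E : Precomplex (DefCat φ)} {p q n : ℤ} (h : p + q = n)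
    (f : PHom D E p) (g : PHom C D q) :
    redEquiv C E n (ext2 (compC2 (DualNumber k) (DefCat φ)) h f g) =
      epsBilin (ext2 (compC2 k a) h) (ext2 φ.1 h) (redEquiv D E p f) (redEquiv C D q g) := by
  rfl

theorem redEquiv_d {C D : Precomplex (DefCat φ)} {p q : ℤ} (h : p + 1 = q) (f : PHom C D p) :
    redEquiv C D q ((pcom (DualNumber k) (DefCat φ)).d h f) =
      epsBilin (ext2 (compC2 k a) (by omega)) (ext2 φ.1 (show 1 + p = q by omega))
          (redEquiv D D 1 D.δ) (redEquiv C D p f) -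
        p.negOnePow • epsBilin (ext2 (compC2 k a) h) (ext2 φ.1 h)
          (redEquiv C D p f) (redEquiv C C 1 C.δ) := by
  rw [← redEquiv_ext2, ← redEquiv_ext2]
  rfl

theorem redEquiv_c (C : Precomplex (DefCat φ)) :
    redEquiv C C 2 ((pcom (DualNumber k) (DefCat φ)).c C) =
      -epsBilin (ext2 (compC2 k a) (by norm_num)) (ext2 φ.1 (show (1 : ℤ) + 1 = 2 by norm_num))
          (redEquiv C C 1 C.δ) (redEquiv C C 1 C.δ) := by
  rw [← redEquiv_ext2]
  rfl

theorem lift_m_re {C' D' E' : Precomplex (DefCat φ)} {C D E : Precomplex a} (hC : C'.red = C)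
    (hD : D'.red = D) (hE : E'.red = E) {p q n : ℤ} (h : p + q = n)
    (f : PHom D' E' p) (g : PHom C' D' q) :
    (liftEquiv hC hE n ((pcom (DualNumber k) (DefCat φ)).m h f g)).re =
      (pcom k a).m h (liftEquiv hD hE p f).re (liftEquiv hC hD q g).re := by
  subst hC hD hE; rfl

theorem lift_d_re {C' D' : Precomplex (DefCat φ)} {C D : Precomplex a} (hC : C'.red = C)
    (hD : D'.red = D) {p q : ℤ} (h : p + 1 = q) (f : PHom C' D' p) :
    (liftEquiv hC hD q ((pcom (DualNumber k) (DefCat φ)).d h f)).re =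
      (pcom k a).d h (liftEquiv hC hD p f).re := by
  subst hC hD; rfl

theorem lift_c_re {C' : Precomplex (DefCat φ)} {C : Precomplex a} (hC : C'.red = C) :
    (liftEquiv hC hC 2 ((pcom (DualNumber k) (DefCat φ)).c C')).re = (pcom k a).c C := by
  subst hC; rfl

/-- Let `Γ` be a family of lifts to precomplexes over `a_φ[ε]` of a family `o` of precomplexes over
`a`. The category spanned by `Γ` (the full subcategory of `PCom(a_φ[ε])`, if the objects are
distinct) is a cdg deformation of the category spanned by `o`. -/
def spanDeformation {T : Type u'} (o : T → Precomplex a) (Γ : T → Precomplex (DefCat φ))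
    (hΓ : ∀ t, (Γ t).red = o t) : Deformation ((pcom k a).pull o) where
  quiv := (preQuiver (DualNumber k) (DefCat φ)).pull Γ
  e A B n := liftEquiv (hΓ A) (hΓ B) n
  str := (pcom (DualNumber k) (DefCat φ)).pull Γ
  isCDG := (pcom_isCDG (DualNumber k) (DefCat φ)).pull Γ
  red_m h f g := lift_m_re (hΓ _) (hΓ _) (hΓ _) h f g
  red_d h f := lift_d_re (hΓ _) (hΓ _) h f
  red_c A := lift_c_re (hΓ A)

theorem rearrange_d {M : Type*} [AddCommGroup M] (s : ℤˣ) (x₁ x₂ x₃ y₁ y₂ y₃ : M) :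
    (x₁ + x₂ + x₃) - s • (y₁ + y₂ + y₃) =
      (x₁ - s • y₂) + ((x₃ - s • y₃) + (x₂ - s • y₁)) := by
  rw [smul_add, smul_add]; abel

theorem rearrange_c {M : Type*} [AddCommGroup M] (x y z : M) :
    -(x + y + z) = -z + -(x - Int.negOnePow 1 • y) := by
  rw [Int.negOnePow_one, Units.neg_smul, one_smul]; abel

variable (φ) in
theorem embr_coboundary_isCDG {T : Type*} (o : T → Precomplex a)
    (h : ∀ t, PHom (o t) (o t) 1) :
    (((pcom k a).pull o).eps
      ((embr φ.1).pull o + ((pcom k a).pull o).coboundaryZero h)).IsCDG := by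
  refine ((pcom_isCDG (DualNumber k) (DefCat φ)).pull (fun t => (o t).lift φ (h t))).transfer
    (fun A B n => redEquiv ((o A).lift φ (h A)) ((o B).lift φ (h B)) n) ?_ ?_ ?_
  · intro A B C p q n hpq f g
    refine (redEquiv_ext2 hpq f g).trans ?_
    exact (LinearMap.congr_fun₂ (congrArg (epsBilin (ext2 (compC2 k a) hpq)) (add_zero _)) _ _).symm
  · intro A B p q hpq f
    exact (redEquiv_d hpq f).trans (Eps.ext rfl (rearrange_d _ _ _ _ _ _ _))
  · intro A
    exact (redEquiv_c _).trans (Eps.ext rfl (rearrange_c _ _ _))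

end Lifts

/-! ## Realization of cocycles as deformations -/

section Realization

variable {k : Type w} [CommRing k] {a : Type u} [Category.{v} a] [Preadditive a] [Linear k a]

/-- The structure `μ + (embr_δ(φ) + d(h))ε` on `k[ε] ⊗ Q`, where `(Q, μ)` is the category spanned by
a family `o` of precomplexes and `h` is a Hochschild cochain on it of arity `0` and degree `1`. -/
def embrDeformation (φ : Z2 k a) {T : Type u'} (o : T → Precomplex a)
    (h : ∀ t, PHom (o t) (o t) 1) : Deformation ((pcom k a).pull o) where
  quiv := ((preQuiver k a).pull o).eps
  e _ _ _ := LinearEquiv.refl _ _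
  str := ((pcom k a).pull o).eps ((embr φ.1).pull o + ((pcom k a).pull o).coboundaryZero h)
  isCDG := embr_coboundary_isCDG φ o h
  red_m _ _ _ := rfl
  red_d _ _ := rfl
  red_c _ := rfl

theorem coboundary_zero_d {C D : Precomplex a} {p q : ℤ} {h : p + 1 = q} (f : PHom C D p)
    (x : PHom C D q) :
    x + (ext2 (compC2 k a) (show 1 + p = q by omega) (0 : PHom D D 1) f -
      p.negOnePow • ext2 (compC2 k a) h f (0 : PHom C C 1)) = x := by
  simp

theorem coboundary_zero_c {C : Precomplex a} (x : (preQuiver k a).Hom C C 2) :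
    x + -(pcom k a).d (show (1 : ℤ) + 1 = 2 by norm_num) (0 : (preQuiver k a).Hom C C 1) = x := by
  rw [map_zero, neg_zero, add_zero]

theorem realization_isCDG (φ : Z2 k a) : ((pcom k a).eps (embr φ.1)).IsCDG := by
  have h0 : (embr φ.1).pull id + ((pcom k a).pull id).coboundaryZero (fun C => (0 : PHom C C 1)) =
      embr φ.1 := by
    refine congr (congr (congrArg Cochain2.mk ?_) ?_) ?_
    · funext A B C p q n h
      exact add_zero _
    · funext A B p q h
      exact LinearMap.ext fun f => coboundary_zero_d (h := h) (f : PHom A B p) _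
    · funext A
      exact coboundary_zero_c _
  have := embr_coboundary_isCDG φ (id : Precomplex a → Precomplex a) (fun C => (0 : PHom C C 1))
  rw [h0] at this
  exact this

/-- The realization `R(φ)`: the cdg deformation `(k[ε] ⊗ PCom(a), μ + embr_δ(φ)ε)`. -/
def realization (φ : Z2 k a) : Deformation (pcom k a) where
  quiv := (preQuiver k a).eps
  e _ _ _ := LinearEquiv.refl _ _
  str := (pcom k a).eps (embr φ.1)
  isCDG := realization_isCDG φ
  red_m _ _ _ := rfl
  red_d _ _ := rfl
  red_c _ := rfl

/-- The subcategory `PCom_Γ(a_φ[ε])` spanned by a collection `Γ` of lifts of all precomplexes, as a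
cdg deformation of `PCom(a)`. -/
def pcomSpan (φ : Z2 k a) (Γ : ∀ C : Precomplex a, {C' : Precomplex (DefCat φ) // C'.red = C}) :
    Deformation (pcom k a) :=
  spanDeformation (o := id) (fun C => (Γ C).1) (fun C => (Γ C).2)

/-- The subcategory `PCom_triv(a_φ[ε])` of trivial precomplexes. -/
def pcomTriv (φ : Z2 k a) : Deformation (pcom k a) :=
  pcomSpan φ (fun C => ⟨C.triv φ, rfl⟩)

/-! ## Complexes -/

/-- A precomplex is a complex if `δ² = 0`. -/
def Precomplex.IsComplex {b : Type u} [Category.{v} b] [Preadditive b] (C : Precomplex b) : Prop :=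
  ∀ (p q r : ℤ) (h : p + 1 = q) (h' : q + 1 = r), C.δ ⟨p, q, h⟩ ≫ C.δ ⟨q, r, h'⟩ = 0

/-- Bounded below complexes. -/
def ComPlus (b : Type u) [Category.{v} b] [Preadditive b] : Type (max u v) :=
  {C : Precomplex b // C.IsComplex ∧ ∃ n : ℤ, ∀ i < n, Limits.IsZero (C.X i)}

/-- The underlying precomplex. -/
def ComPlus.pre {b : Type u} [Category.{v} b] [Preadditive b] (C : ComPlus b) : Precomplex b := C.1

variable (k a) in
/-- The dg category of bounded below complexes, as a full subcategory of `PCom(a)`. -/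
def comPlus : Cochain2 ((preQuiver k a).pull (ComPlus.pre (b := a))) :=
  (pcom k a).pull ComPlus.pre

theorem pcom_c_eq_zero {C : Precomplex a} (hC : C.IsComplex) : (pcom k a).c C = 0 := by
  refine neg_eq_zero.mpr (funext fun t => ?_)
  exact hC _ _ _ _ _

/-- The objects of `Com⁺(a)_{φ-∞}`: the complexes `C` for which the class of
`(embr_δ(φ))_C = -φ(δ_C, δ_C)` in `H²(Com⁺(a)(C, C))` is zero. -/
def phiInf (φ : Z2 k a) : Set (ComPlus a) :=
  {C | ∃ h : PHom C.pre C.pre 1,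
    (pcom k a).d (show (1 : ℤ) + 1 = 2 by norm_num) h = (embr φ.1).c C.pre}

/-- For `h ∈ ∏_C Com⁺(a)(C, C)¹` with `d(h_C) = (embr_δ(φ))_C` for all `C ∈ Com⁺(a)_{φ-∞}`, the
partial dg deformation of `Com⁺(a)` determined by the cocycle `embr_δ(φ) + d(h)`, the
component of arity `0` of which is zero, on `Com⁺(a)_{φ-∞}`. -/
def embrPartial (φ : Z2 k a) (h : ∀ C : phiInf φ, PHom C.1.pre C.1.pre 1)
    (hh : ∀ C : phiInf φ,
      (pcom k a).d (show (1 : ℤ) + 1 = 2 by norm_num) (h C) = (embr φ.1).c C.1.pre) :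
    PartialDG (comPlus k a) where
  S := phiInf φ
  D := embrDeformation φ (fun C : phiInf φ => C.1.pre) h
  isDG C := by
    refine Eps.ext (pcom_c_eq_zero C.1.2.1) ?_
    exact (congrArg (fun x => (embr φ.1).c C.1.pre + -x) (hh C)).trans (add_neg_cancel _)

/-- The map `ρ' : HH²(a) → HH²(Com⁺(a)) → Sk(dg-pDef)`: the class of the partial deformation
determined by a representing cocycle `φ` and a choice of `h` as in `embrPartial`. -/
noncomputable def rhoPrime (x : HH2 k a) : PartialDG.Sk (comPlus k a) :=
  PartialDG.Sk.mk (embrPartial (Quotient.out x) (fun C => Classical.choose C.2)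
    (fun C => Classical.choose_spec C.2))

/-- The full subcategory `Com⁺_Γ(a_φ[ε])` of `Com⁺(a_φ[ε])` spanned by a collection `Γ` of lifts of
the complexes in `Com⁺(a)_{φ-∞}` to complexes over `a_φ[ε]`, as a partial dg deformation. -/
def comSpan (φ : Z2 k a)
    (Γ : ∀ C : phiInf φ, {C' : Precomplex (DefCat φ) // C'.red = C.1.pre ∧ C'.IsComplex}) :
    PartialDG (comPlus k a) where
  S := phiInf φ
  D := spanDeformation (o := fun C : phiInf φ => C.1.pre) (fun C => (Γ C).1) (fun C => (Γ C).2.1)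
  isDG C := pcom_c_eq_zero (Γ C).2.2

/-- The complex with `A` in degree `0` and the zero object `Z` in all other degrees. -/
def stalk (A Z : a) (hZ : Limits.IsZero Z) : ComPlus a :=
  ⟨⟨fun i => if i = 0 then A else Z, fun _ => 0⟩, by
    intro p q r h h'; simp, ⟨0, fun i hi => by
      change Limits.IsZero (if i = 0 then A else Z)
      rw [if_neg (by omega)]; exact hZ⟩⟩

end Realization

end LowenDef

open LowenDef

/-! The bridge between the two sides is that composing in `a_φ[ε]` with a differential `δ + hε` and
reading off the coefficient of `ε` produces exactly `embr_δ(φ) + d(h)`. Hence a category spanned by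
lifts coincides with the corresponding embedded deformation (`embrDeformation_coincide`,
`realization_coincide`).

The choice of lifts and of the representing cocycle does not matter, because curvature may be
absorbed in arity `0`. If `φ = φ' + d g`, then `1 + gε` is a functor `a_φ[ε] → a_φ'[ε]`. It need not
match two given lifted differentials, but taking `F₀` to be their difference makes it a morphism of
cdg categories, and `F₀` is divisible by `ε` since both differentials lift the same `δ`
(`spanLift_curvedIso`). For complexes, `d(h) = -φ(δ, δ)` says that `(δ + hε)² = 0` in `a_φ[ε]`, so
`phiInf φ` consists of the complexes that lift to complexes, and it depends only on the class of `φ`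
(`phiInf_subset`).

For the converse, let `D` be a deformation of a full subcategory containing all stalk complexes.
Between stalks only degree `0` survives, so `D` restricts to some `a_φ[ε]` (`exists_isCharCocycle`),
and for degree reasons an `A_{[0,∞[}`-isomorphism restricts to a functor there, so that `[φ]` is an
invariant (`IsCharCocycle.exists_sub_eq_d1`). Moreover `D` is recovered from `φ`: morphisms from a
stalk to `C` are freely generated by the inclusions of the components `C^p`, as this holds modulo
`ε`. Writing the action of morphisms and of `d` in these generators gives a lift of each `C` over
`a_φ[ε]` and an isomorphism from `D` to the span of these lifts
(`IsCharCocycle.curvedIso_spanLift`). If `D` is a dg deformation, the lifts are complexes, so its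
objects lie in `phiInf φ` (`IsCharCocycle.subset_phiInf`).

Maximality of the deformations on `phiInf φ`, injectivity of `ρ` and the description of its image
all follow from this invariant and this reconstruction. -/

namespace LowenDef

/-! ### Curved functors as `A_{[0,∞[}`-morphisms -/

section Curved

variable {R : Type w} [CommRing R] {T : Type u}

/-- A morphism of cdg categories with fixed objects: an `A_{[0,∞[}`-morphism with components in
arities `0` and `1` only. -/
structure CurvedFunctor {Q Q' : GrQuiver.{w, v} R T} (μ : Cochain2 Q) (μ' : Cochain2 Q') where
  F₀ : ∀ A : T, Q'.Hom A A 1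
  F₁ : ∀ (A B : T) (n : ℤ), Q.Hom A B n →ₗ[R] Q'.Hom A B n
  map_c : ∀ A : T,
    μ'.c A - μ'.d (show (1 : ℤ) + 1 = 2 by norm_num) (F₀ A) -
        μ'.m (show (1 : ℤ) + 1 = 2 by norm_num) (F₀ A) (F₀ A) = F₁ A A 2 (μ.c A)
  map_d : ∀ {A B : T} {p q : ℤ} (h : p + 1 = q) (f : Q.Hom A B p),
    F₁ A B q (μ.d h f) = μ'.d h (F₁ A B p f) +
      μ'.m (show 1 + p = q by omega) (F₀ B) (F₁ A B p f) -
        p.negOnePow • μ'.m h (F₁ A B p f) (F₀ A)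
  map_m : ∀ {A B C : T} {p q n : ℤ} (h : p + q = n) (f : Q.Hom B C p) (g : Q.Hom A B q),
    F₁ A C n (μ.m h f g) = μ'.m h (F₁ B C p f) (F₁ A B q g)

namespace CurvedFunctor

variable {Q Q' Q'' : GrQuiver.{w, v} R T} {μ : Cochain2 Q} {μ' : Cochain2 Q'} {μ'' : Cochain2 Q''}

/-- The components of the `A_{[0,∞[}`-morphism determined by a curved functor. -/
def onPath (F : CurvedFunctor μ μ') : ∀ {A B : T}, Path Q A B → ∀ e : ℤ, Q'.Hom A B e
  | _, _, .nil A, e => if h : (1 : ℤ) = e then h ▸ F.F₀ A else 0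
  | A, B, .cons (n := n) f (.nil _), e => if h : n = e then h ▸ F.F₁ A B n f else 0
  | _, _, .cons _ (.cons _ _), _ => 0

theorem onPath_nil (F : CurvedFunctor μ μ') (A : T) : F.onPath (.nil A) 1 = F.F₀ A := by
  simp [onPath]

theorem onPath_single (F : CurvedFunctor μ μ') {A B : T} {n : ℤ} (f : Q.Hom A B n) :
    F.onPath (.cons f (.nil A)) n = F.F₁ A B n f := by
  simp [onPath]

theorem onPath_single_ne (F : CurvedFunctor μ μ') {A B : T} {n e : ℤ} (h : n ≠ e)
    (f : Q.Hom A B n) : F.onPath (.cons f (.nil A)) e = 0 := by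
  simp [onPath, h]

theorem onPath_nil_ne (F : CurvedFunctor μ μ') {A : T} {e : ℤ} (h : 1 ≠ e) :
    F.onPath (.nil A) e = 0 := by
  simp [onPath, h]

@[simp] theorem onPath_cons_cons (F : CurvedFunctor μ μ') {A B C D : T} {n n' : ℤ}
    (f : Q.Hom C D n) (g : Q.Hom B C n') (p : Path Q A B) (e : ℤ) :
    F.onPath (.cons f (.cons g p)) e = 0 := rfl

/-- In `AMor.eq_cons` the degrees occur as expressions such as `l.sdeg + 1` and `e - (l.sdeg + 1)`.
Keeping them as variables `x`, `y` with equations makes the transport along these equalities a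
substitution. -/
theorem onPath_nil_single (F : CurvedFunctor μ μ') {A B : T} {n x y e : ℤ} (f : Q.Hom A B n)
    (hx : x = 1) (hy : y = n) (h : x + y = e) :
    μ'.m h (F.onPath (.nil B) x) (F.onPath (.cons f (.nil A)) y) =
      μ'.m (show 1 + n = e by omega) (F.F₀ B) (F.F₁ A B n f) := by
  subst hx hy; rw [onPath_nil, onPath_single]

theorem onPath_single_nil (F : CurvedFunctor μ μ') {A B : T} {n x y e : ℤ} (f : Q.Hom A B n)
    (hx : x = n) (hy : y = 1) (h : x + y = e) :
    μ'.m h (F.onPath (.cons f (.nil A)) x) (F.onPath (.nil A) y) =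
      μ'.m (show n + 1 = e by omega) (F.F₁ A B n f) (F.F₀ A) := by
  subst hx hy; rw [onPath_nil, onPath_single]

theorem onPath_single_single (F : CurvedFunctor μ μ') {A B C : T} {n n' x y e : ℤ}
    (f : Q.Hom B C n) (g : Q.Hom A B n') (hx : x = n) (hy : y = n') (h : x + y = e) :
    μ'.m h (F.onPath (.cons f (.nil B)) x) (F.onPath (.cons g (.nil A)) y) =
      μ'.m (show n + n' = e by omega) (F.F₁ B C n f) (F.F₁ A B n' g) := by
  subst hx hy; rw [onPath_single, onPath_single]

theorem onPath_map_d (F : CurvedFunctor μ μ') {A B : T} {n e : ℤ} (h : n + 1 = e)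
    (f : Q.Hom A B n) :
    F.onPath (.cons (μ.d rfl f) (.nil A)) e = F.F₁ A B e (μ.d h f) := by
  subst h; rw [onPath_single]

theorem onPath_map_m (F : CurvedFunctor μ μ') {A B C : T} {p q n : ℤ} (h : p + q = n)
    (f : Q.Hom B C p) (g : Q.Hom A B q) :
    F.onPath (.cons (μ.m rfl f g) (.nil A)) n = F.F₁ A C n (μ.m h f g) := by
  subst h; rw [onPath_single]

theorem onPath_append_cons_cons (F : CurvedFunctor μ μ') {A B C D E : T} {n n' : ℤ}
    (l : Path Q D E) (f : Q.Hom C D n) (g : Q.Hom B C n') (p : Path Q A B) (e : ℤ) :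
    F.onPath (l.append (.cons f (.cons g p))) e = 0 := by
  cases l with
  | nil => rfl
  | cons a l => cases l <;> rfl

theorem onPath_cons_append_cons (F : CurvedFunctor μ μ') {A B C D E : T} {n n' : ℤ}
    (a : Q.Hom D E n) (l : Path Q C D) (f : Q.Hom B C n') (p : Path Q A B) (e : ℤ) :
    F.onPath ((Path.cons a l).append (.cons f p)) e = 0 := by
  cases l <;> rfl

theorem sumSplit_zero {M : Type v} [AddCommGroup M] {A C : T} (p : Path Q A C)
    (Φ : ∀ B : T, Path Q B C → Path Q A B → M) (h : ∀ B l r, Φ B l r = 0) :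
    p.sumSplit Φ = 0 := by
  induction p with
  | nil => exact h _ _ _
  | cons f p ih => rw [Path.sumSplit, h, zero_add]; exact ih _ fun _ _ _ => h _ _ _

/-- Inserting `b` never produces an empty sequence: `b_0` adds an entry, `b_1` keeps the length, and
`b_2` merges two entries into one. So vanishing on nonempty sequences suffices. -/
theorem sumInsert_zero {M : Type v} [AddCommGroup M] {A C : T} (p : Path Q A C)
    (Φ : Path Q A C → M) (h : ∀ {B : T} {n : ℤ} (f : Q.Hom B C n) (q : Path Q A B),
      Φ (.cons f q) = 0) : p.sumInsert μ Φ = 0 := by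
  induction p with
  | nil => exact h _ _
  | cons f p ih =>
    rw [Path.sumInsert, h, h, ih _ fun _ _ => h _ _]
    cases p with
    | nil => simp [Path.contractFirst]
    | cons g p => simp [Path.contractFirst, h]

/-- The `A_{[0,∞[}`-morphism determined by a curved functor. -/
def toAMor (F : CurvedFunctor μ μ') : AMor μ μ' where
  F := F.onPath
  F_deg p e h := by
    cases p with
    | nil => exact F.onPath_nil_ne (by simpa [Path.sdeg] using h.symm)
    | cons f p =>
      cases p with
      | nil => exact F.onPath_single_ne (by simpa [Path.sdeg] using h.symm) f
      | cons g p => rfl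
  F_add {A B C D n} l f g r e := by
    cases l with
    | cons a l => simp only [onPath_cons_append_cons, add_zero]
    | nil =>
      cases r with
      | cons b r => simp only [onPath_append_cons_cons, add_zero]
      | nil =>
        change F.onPath (.cons (f + g) _) e = F.onPath (.cons f _) e + F.onPath (.cons g _) e
        by_cases h : n = e
        · subst h; simp only [onPath_single, map_add]
        · simp only [F.onPath_single_ne h, add_zero]
  F_smul {A B C D n} l x f r e := by
    cases l with
    | cons a l => simp only [onPath_cons_append_cons, smul_zero]
    | nil =>
      cases r with
      | cons b r => simp only [onPath_append_cons_cons, smul_zero]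
      | nil =>
        change F.onPath (.cons (x • f) _) e = x • F.onPath (.cons f _) e
        by_cases h : n = e
        · subst h; simp only [onPath_single, map_smul]
        · simp only [F.onPath_single_ne h, smul_zero]
  eq_nil A := by
    rw [onPath_nil, onPath_single]; exact F.map_c A
  eq_cons {A B C n} f p i e hi he := by
    cases p with
    | nil =>
      -- In arity one the equation is `map_d`; its two terms with `F₀` come from the two splittings
      -- of a one-term sequence.
      obtain rfl : i = n := by simpa [Path.sdeg] using hi.symm
      rw [onPath_single]
      simp only [Path.sumSplit, Path.sumInsert, Path.contractFirst, onPath_cons_cons, smul_zero,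
        add_zero, zero_sub]
      rw [onPath_nil_single _ _ (by simp [Path.sdeg]) (by simp [Path.sdeg]; omega),
        onPath_single_nil _ _ (by simp [Path.sdeg]) (by simp [Path.sdeg]; omega),
        onPath_map_d F he, F.map_d]
      simp only [Path.sdeg, zero_add, add_zero, sub_add_cancel, Int.negOnePow_one,
        Units.neg_smul, one_smul]
      abel
    | @cons _ _ n' g p =>
      rw [onPath_cons_cons, map_zero, neg_zero, zero_add]
      cases p with
      | nil =>
        obtain rfl : e = n + n' := by simp [Path.sdeg] at hi; omega
        simp only [Path.sumSplit, Path.sumInsert, Path.contractFirst, onPath_cons_cons, smul_zero,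
          add_zero, map_zero, zero_sub, neg_zero, zero_add, LinearMap.zero_apply]
        rw [onPath_single_single _ _ _ (by simp [Path.sdeg]) (by simp [Path.sdeg]),
          F.onPath_map_m rfl, F.map_m]
        simp [Path.sdeg]
      | cons x p =>
        -- With at least three entries, every splitting has a factor of length at least two and
        -- every insertion leaves length at least two, where the morphism vanishes.
        rw [Path.sumInsert, sumInsert_zero _ _ fun _ _ => onPath_cons_cons _ _ _ _ _]
        simp only [Path.sumSplit, Path.contractFirst, onPath_cons_cons, smul_zero,
          add_zero, map_zero, sub_zero, zero_add, LinearMap.zero_apply]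
        exact sumSplit_zero _ _ (by intros; simp)

/-- Composition of curved functors. -/
def comp (G : CurvedFunctor μ' μ'') (F : CurvedFunctor μ μ') : CurvedFunctor μ μ'' where
  F₀ A := G.F₀ A + G.F₁ A A 1 (F.F₀ A)
  F₁ A B n := (G.F₁ A B n).comp (F.F₁ A B n)
  map_c A := by
    rw [LinearMap.comp_apply, ← F.map_c, map_sub, map_sub, ← G.map_c, G.map_d, G.map_m]
    simp only [map_add, LinearMap.add_apply, Int.negOnePow_one, Units.neg_smul, one_smul]
    abel
  map_d h f := by
    simp only [LinearMap.comp_apply, F.map_d, map_add, map_sub, G.map_d, G.map_m,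
      LinearMap.add_apply, smul_add, Units.smul_def, map_zsmul]
    abel
  map_m h f g := by
    simp only [LinearMap.comp_apply, F.map_m, G.map_m]

end CurvedFunctor

end Curved

/-! ### Isomorphisms of deformations given by curved functors -/

section CurvedDeformations

variable {k : Type w} [CommRing k] {T : Type u} {Q : GrQuiver.{w, v} k T} {μ : Cochain2 Q}

namespace Deformation

/-- Two deformations are isomorphic by a curved functor reducing to the identity. -/
def CurvedIso (D D' : Deformation μ) : Prop :=
  ∃ F : CurvedFunctor D.str D'.str,
    (∀ A : T, (D'.e A A 1 (F.F₀ A)).re = 0) ∧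
    ∀ {A B : T} {n : ℤ} (f : D.quiv.Hom A B n), (D'.e A B n (F.F₁ A B n f)).re = (D.e A B n f).re

theorem CurvedIso.iso {D D' : Deformation μ} (h : D.CurvedIso D') : D.Iso D' := by
  obtain ⟨F, h0, h1⟩ := h
  refine ⟨F.toAMor, fun A i => ?_, fun {A B n} f => ?_, fun f g p i => ?_⟩
  · change (D'.e A A i (F.onPath (.nil A) i)).re = 0
    by_cases h : 1 = i
    · subst h; rw [F.onPath_nil, h0]
    · rw [F.onPath_nil_ne h, map_zero, Eps.re_zero]
  · change (D'.e A B n (F.onPath (.cons f (.nil A)) n)).re = _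
    rw [F.onPath_single, h1]
  · change (D'.e _ _ i (F.onPath (.cons f (.cons g p)) i)).re = 0
    rw [F.onPath_cons_cons, map_zero, Eps.re_zero]

/-- All isomorphisms that have to be constructed are of this special kind, so they can be composed
before passing to `Iso`, without composing general `A_{[0,∞[}`-morphisms. -/
theorem CurvedIso.trans {D D' D'' : Deformation μ} (h : D.CurvedIso D') (h' : D'.CurvedIso D'') :
    D.CurvedIso D'' := by
  obtain ⟨F, h0, h1⟩ := h
  obtain ⟨G, h0', h1'⟩ := h'
  refine ⟨G.comp F, fun A => ?_, fun f => (h1' _).trans (h1 f)⟩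
  change (D''.e A A 1 (G.F₀ A + G.F₁ A A 1 (F.F₀ A))).re = 0
  rw [map_add, Eps.re_add, h0', h1', h0, add_zero]

theorem Coincide.curvedIso {D D' : Deformation μ} (h : D.Coincide D') : D.CurvedIso D' := by
  obtain ⟨hm, hd, hc⟩ := h
  refine ⟨⟨fun _ => 0, fun A B n => ((D.e A B n).trans (D'.e A B n).symm).toLinearMap, ?_, ?_, ?_⟩,
    fun A => ?_, fun f => ?_⟩
  · intro A
    rw [map_zero, map_zero, sub_zero, sub_zero]
    change _ = (D'.e A A 2).symm (D.e A A 2 (D.str.c A))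
    rw [hc, LinearEquiv.symm_apply_apply]
  · intro A B p q h f
    change (D'.e A B q).symm (D.e A B q (D.str.d h f)) =
      D'.str.d h ((D'.e A B p).symm (D.e A B p f)) + _ - _
    rw [map_zero, map_zero, smul_zero, sub_zero, LinearMap.zero_apply, add_zero,
      LinearEquiv.symm_apply_eq, ← hd, LinearEquiv.symm_apply_apply]
  · intro A B C p q n h f g
    change (D'.e A C n).symm (D.e A C n (D.str.m h f g)) =
      D'.str.m h ((D'.e B C p).symm (D.e B C p f)) ((D'.e A B q).symm (D.e A B q g))
    rw [LinearEquiv.symm_apply_eq, ← hm, LinearEquiv.symm_apply_apply,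
      LinearEquiv.symm_apply_apply]
  · rw [map_zero, Eps.re_zero]
  · change (D'.e _ _ _ ((D'.e _ _ _).symm (D.e _ _ _ f))).re = _
    rw [LinearEquiv.apply_symm_apply]

end Deformation

end CurvedDeformations

/-! ### Independence of the lifts and of the representing cocycle -/

section Twist

variable {k : Type w} [CommRing k] {a : Type u} [Category.{v} a] [Preadditive a] [Linear k a]

/-- Composition of graded morphisms. -/
abbrev gcomp (R : Type w) [CommRing R] {b : Type u} [Category.{v} b] [Preadditive b] [Linear R b]
    {C D E : Precomplex b} {p q n : ℤ} (h : p + q = n) :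
    PHom D E p →ₗ[R] PHom C D q →ₗ[R] PHom C E n :=
  ext2 (compC2 R b) h

theorem epsBilin_apply {M N P : Type v} [AddCommGroup M] [AddCommGroup N] [AddCommGroup P]
    [Module k M] [Module k N] [Module k P] (f g : M →ₗ[k] N →ₗ[k] P) (x : Eps M) (y : Eps N) :
    epsBilin f g x y = ⟨f x.re y.re, f x.re y.im + f x.im y.re + g x.re y.re⟩ := rfl

theorem epsLin_apply {M N : Type v} [AddCommGroup M] [AddCommGroup N] [Module k M] [Module k N]
    (f g : M →ₗ[k] N) (x : Eps M) : epsLin f g x = ⟨f x.re, f x.im + g x.re⟩ := rfl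

/-- Composition in `a_φ[ε]`. -/
def epsComp (φ : Z2 k a) (A B C : a) :
    Eps (B ⟶ C) →ₗ[DualNumber k] Eps (A ⟶ B) →ₗ[DualNumber k] Eps (A ⟶ C) :=
  epsBilin (compC2 k a A B C) (φ.1 A B C)

/-- The functor `a_φ[ε] → a_φ'[ε]`, `f ↦ f + g(f)ε`, on morphisms. -/
def twist (g : C1 k a) (A B : a) : Eps (A ⟶ B) →ₗ[DualNumber k] Eps (A ⟶ B) :=
  epsLin LinearMap.id (g A B)

/-- Modulo `ε` there is nothing to check, and the coefficient of `ε` of multiplicativity of `1 + gε`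
is the coboundary relation `hg`. -/
theorem twist_epsComp {φ φ' : Z2 k a} {g : C1 k a} (hg : φ.1 = φ'.1 + d1 k a g) {A B C : a}
    (y : Eps (B ⟶ C)) (x : Eps (A ⟶ B)) :
    twist g A C (epsComp φ A B C y x) = epsComp φ' A B C (twist g B C y) (twist g A B x) := by
  refine Eps.ext rfl ?_
  change x.im ≫ y.re + x.re ≫ y.im + φ.1 A B C y.re x.re + g A C (x.re ≫ y.re) =
    (x.im + g A B x.re) ≫ y.re + x.re ≫ (y.im + g B C y.re) + φ'.1 A B C y.re x.re
  rw [hg, C2.add_apply]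
  change _ + (_ + (x.re ≫ g B C y.re - g A C (x.re ≫ y.re) + g A B x.re ≫ y.re)) + _ = _
  simp only [Preadditive.add_comp, Preadditive.comp_add]
  abel

theorem defCat_comp {φ : Z2 k a} {A B C : DefCat φ} (x : A ⟶ B) (y : B ⟶ C) :
    x ≫ y = epsComp φ A.base B.base C.base y x := rfl

variable {T : Type u'}

/-- The category spanned by the lifts `δ + δ'ε` of a family of precomplexes. -/
def spanLift (φ : Z2 k a) (o : T → Precomplex a) (δ' : ∀ t, PHom (o t) (o t) 1) :
    Deformation ((pcom k a).pull o) :=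
  spanDeformation o (fun t => (o t).lift φ (δ' t)) (fun _ => rfl)

/-- The action of `twist` on graded morphisms. -/
def twistHom (φ φ' : Z2 k a) (g : C1 k a) {C D : Precomplex a} (γ γ' : PHom C C 1)
    (δ δ' : PHom D D 1) (n : ℤ) :
    PHom (C.lift φ γ) (D.lift φ δ) n →ₗ[DualNumber k] PHom (C.lift φ' γ') (D.lift φ' δ') n :=
  LinearMap.pi fun t => (twist g (C.X t.p) (D.X t.q)).comp (LinearMap.proj t)

theorem twistHom_gcomp {φ φ' : Z2 k a} {g : C1 k a} (hg : φ.1 = φ'.1 + d1 k a g)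
    {C D E : Precomplex a} (γ γ' : PHom C C 1) (δ δ' : PHom D D 1) (η η' : PHom E E 1)
    {p q n : ℤ} (h : p + q = n) (f : PHom (D.lift φ δ) (E.lift φ η) p)
    (e : PHom (C.lift φ γ) (D.lift φ δ) q) :
    twistHom φ φ' g γ γ' η η' n (gcomp (DualNumber k) h f e) =
      gcomp (DualNumber k) h (twistHom φ φ' g δ δ' η η' p f)
        (twistHom φ φ' g γ γ' δ δ' q e) := by
  funext t
  exact (congrArg (twist g _ _) (defCat_comp _ _)).trans
    ((twist_epsComp hg _ _).trans (defCat_comp _ _).symm)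

/-- With `x` the image of the first differential and `y` the second differential, `F₀ = x - y`
corrects `y` to `y + F₀ = x`. The curvature equation becomes `-x² = -x²` and compatibility with `d`
becomes the commutator with `x`. No relation between `δ` and `δ'` is needed, which gives
independence of the lifts. -/
theorem spanLift_curvedIso {φ φ' : Z2 k a} {g : C1 k a} (hg : φ.1 = φ'.1 + d1 k a g)
    (o : T → Precomplex a) (δ δ' : ∀ t, PHom (o t) (o t) 1) :
    (spanLift φ o δ).CurvedIso (spanLift φ' o δ') := by
  let G := fun (A B : T) n => twistHom φ φ' g (δ A) (δ' A) (δ B) (δ' B) n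
  have hm : ∀ {A B C : T} {p q n : ℤ} (h : p + q = n) f e,
      G A C n (gcomp _ h f e) = gcomp (DualNumber k) h (G B C p f) (G A B q e) :=
    fun h f e => twistHom_gcomp hg _ _ _ _ _ _ h f e
  let L := fun A => (o A).lift φ (δ A)
  let L' := fun A => (o A).lift φ' (δ' A)
  refine ⟨⟨fun A => G A A 1 (L A).δ - (L' A).δ, G, fun A => ?_, fun {A B p q} h f => ?_, hm⟩,
    fun A => ?_, fun f => rfl⟩
  · have h2 : (1 : ℤ) + 1 = 2 := by norm_num
    let x := G A A 1 (L A).δ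
    let y := (L' A).δ
    have : -gcomp (DualNumber k) h2 y y - (gcomp (DualNumber k) h2 y (x - y) -
        Int.negOnePow 1 • gcomp (DualNumber k) h2 (x - y) y) -
          gcomp (DualNumber k) h2 (x - y) (x - y) =
        G A A 2 (-gcomp (DualNumber k) h2 (L A).δ (L A).δ) := by
      rw [map_neg, hm]
      simp only [map_sub, LinearMap.sub_apply, Int.negOnePow_one, Units.neg_smul, one_smul]
      change _ = -gcomp (DualNumber k) h2 x x
      abel
    exact this
  · let x := G A A 1 (L A).δ
    let y := (L' A).δ
    let x' := G B B 1 (L B).δ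
    let y' := (L' B).δ
    have h' : 1 + p = q := by omega
    change PHom (L A) (L B) p at f
    have e₁ : G A B q (gcomp _ h' (L B).δ f) = gcomp (DualNumber k) h' x' (G A B p f) := hm _ _ _
    have e₂ : G A B q (gcomp _ h f (L A).δ) = gcomp (DualNumber k) h (G A B p f) x := hm _ _ _
    have : G A B q (gcomp (DualNumber k) h' (L B).δ f -
          p.negOnePow • gcomp (DualNumber k) h f (L A).δ) =
        (gcomp (DualNumber k) h' y' (G A B p f) -
          p.negOnePow • gcomp (DualNumber k) h (G A B p f) y) +
        gcomp (DualNumber k) h' (x' - y') (G A B p f) -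
          p.negOnePow • gcomp (DualNumber k) h (G A B p f) (x - y) := by
      rw [Units.smul_def, map_sub, map_zsmul, e₁, e₂]
      simp only [map_sub, LinearMap.sub_apply, smul_sub]
      abel
    exact this
  -- Both differentials reduce to that of `o A`, so `F₀` is divisible by `ε`.
  · funext t
    change (o A).δ t - (o A).δ t = 0
    exact sub_self _

theorem exists_eq_lift {φ : Z2 k a} {C' : Precomplex (DefCat φ)} {C : Precomplex a}
    (h : C'.red = C) : ∃ δ', C' = C.lift φ δ' := by
  subst h; exact ⟨fun t => (C'.δ t).im, rfl⟩

/-- A precomplex reducing to `C` literally is `C.lift φ δ'`, so the deformations agree as an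
equality and the special form `spanLift` loses no generality. -/
theorem spanDeformation_eq_spanLift {φ : Z2 k a} (o : T → Precomplex a)
    (Γ : T → Precomplex (DefCat φ)) (hΓ : ∀ t, (Γ t).red = o t) :
    ∃ δ', spanDeformation o Γ hΓ = spanLift φ o δ' := by
  choose δ' h using fun t => exists_eq_lift (hΓ t)
  obtain rfl : Γ = _ := funext h
  exact ⟨δ', rfl⟩

/-- Expanding products with `δ + hε` in `a_φ[ε]`, the coefficient of `ε` splits into the terms with
`φ`, which form `embr_δ(φ)`, and the terms with `h`, which form `d(h)`. -/
theorem embrDeformation_coincide (φ : Z2 k a) (o : T → Precomplex a)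
    (h : ∀ t, PHom (o t) (o t) 1) : (embrDeformation φ o h).Coincide (spanLift φ o h) := by
  refine ⟨fun {A B C p q n} hpq f g => ?_, fun {A B p q} hpq f => ?_, fun A => ?_⟩
  · refine Eq.trans ?_ (redEquiv_ext2 (C := (o A).lift φ (h A)) (D := (o B).lift φ (h B))
      (E := (o C).lift φ (h C)) hpq _ _).symm
    exact LinearMap.congr_fun₂ (congrArg (epsBilin (ext2 (compC2 k a) hpq)) (add_zero _)) _ _
  · refine Eq.symm ?_
    refine (redEquiv_d (C := (o A).lift φ (h A)) (D := (o B).lift φ (h B)) hpq _).trans ?_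
    exact Eps.ext rfl (rearrange_d _ _ _ _ _ _ _)
  · refine Eq.symm ?_
    refine (redEquiv_c ((o A).lift φ (h A))).trans ?_
    exact Eps.ext rfl (rearrange_c _ _ _)

theorem Deformation.Coincide.symm {T : Type u} {Q : GrQuiver.{w, v} k T} {μ : Cochain2 Q}
    {D D' : Deformation μ} (h : D.Coincide D') : D'.Coincide D :=
  ⟨fun h' f g => (h.1 h' f g).symm, fun h' f => (h.2.1 h' f).symm, fun A => (h.2.2 A).symm⟩

theorem realization_coincide (φ : Z2 k a) : (realization φ).Coincide (pcomTriv φ) := by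
  obtain ⟨hm, hd, hc⟩ := embrDeformation_coincide φ (id : Precomplex a → Precomplex a) fun _ => 0
  -- For trivial lifts `h = 0`, so the coboundary contributes nothing and the embedded cocycle is
  -- `embr_δ(φ)` itself.
  have h0 : (embr φ.1).pull id + ((pcom k a).pull id).coboundaryZero (fun C => (0 : PHom C C 1)) =
      embr φ.1 := by
    refine congr (congr (congrArg Cochain2.mk ?_) ?_) ?_
    · funext A B C p q n h
      exact add_zero _
    · funext A B p q h
      exact LinearMap.ext fun f => coboundary_zero_d (h := h) (f : PHom A B p) _
    · funext A
      exact coboundary_zero_c _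
  have h1 : (embrDeformation φ (id : Precomplex a → Precomplex a) fun _ => 0).str =
      (realization φ).str := congrArg (Cochain2.eps (pcom k a)) h0
  refine ⟨fun {A B C p q n} h f g => ?_, fun {A B p q} h f => ?_, fun A => ?_⟩
  · rw [← h1]; exact hm h f g
  · rw [← h1]; exact hd h f
  · rw [← h1]; exact hc A

/-- The functor `1 + gε` carries the square zero lift `δ + hε` to `δ + (h + g(δ))ε`, which explains
the witness `h + G`. In the computation of `d(G)` the term `g(δδ)` of the coboundary disappears
because `δ² = 0`. -/
theorem phiInf_subset {φ φ' : Z2 k a} {g : C1 k a} (hg : φ.1 = φ'.1 + d1 k a g) :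
    phiInf φ ⊆ phiInf φ' := by
  rintro C ⟨h, hh⟩
  let G : PHom C.pre C.pre 1 := fun t => g _ _ (C.pre.δ t)
  refine ⟨h + G, ?_⟩
  have hG : (pcom k a).d (show (1 : ℤ) + 1 = 2 by norm_num) G =
      -((embr φ.1).c C.pre - (embr φ'.1).c C.pre) := by
    funext ⟨p, q, hpq⟩
    let d1 := C.pre.δ ⟨p, p + 1, rfl⟩
    let d2 := C.pre.δ ⟨p + 1, q, by omega⟩
    have hd : d1 ≫ d2 = 0 := C.2.1 _ _ _ _ _
    change g _ _ d1 ≫ d2 - Int.negOnePow 1 • d1 ≫ g _ _ d2 =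
      -(-φ.1 _ _ _ d2 d1 - -φ'.1 _ _ _ d2 d1)
    rw [hg, C2.add_apply]
    change _ = -(-(_ + (d1 ≫ g _ _ d2 - g _ _ (d1 ≫ d2) + g _ _ d1 ≫ d2)) - - _)
    rw [hd, map_zero, Int.negOnePow_one, Units.neg_smul, one_smul]
    abel
  refine (map_add _ _ _).trans ?_
  rw [hh, hG]
  abel

end Twist
-- Linear maps over the dual numbers
section EpsMaps

variable {k : Type w} [CommRing k] {M N P : Type v} [AddCommGroup M] [AddCommGroup N]
  [AddCommGroup P] [Module k M] [Module k N] [Module k P]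

theorem Eps.eps_smul (y : M) : (DualNumber.eps : DualNumber k) • (⟨y, 0⟩ : Eps M) = ⟨0, y⟩ := by
  ext <;> simp

theorem Eps.inl_smul (r : k) (y : M) :
    (TrivSqZeroExt.inl r : DualNumber k) • (⟨y, 0⟩ : Eps M) = ⟨r • y, 0⟩ := by
  ext <;> simp

theorem Eps.eq_add_eps_smul (x : Eps M) :
    x = ⟨x.re, 0⟩ + (DualNumber.eps : DualNumber k) • (⟨x.im, 0⟩ : Eps M) := by
  rw [Eps.eps_smul]; ext <;> simp

theorem Eps.add_mk (x y : M) : (⟨x + y, 0⟩ : Eps M) = ⟨x, 0⟩ + ⟨y, 0⟩ := by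
  ext <;> simp

/-- `Eps M` is generated over `k[ε]` by the elements `⟨x, 0⟩`, so `L` is determined by its values
there, with `g` the coefficient of `ε` of these values. -/
theorem exists_eq_epsLin (L : Eps M →ₗ[DualNumber k] Eps N) (f : M →ₗ[k] N)
    (h : ∀ x, (L x).re = f x.re) : ∃ g, L = epsLin f g := by
  refine ⟨⟨⟨fun x => (L ⟨x, 0⟩).im, fun x y => ?_⟩, fun r x => ?_⟩, LinearMap.ext fun x => ?_⟩
  · rw [Eps.add_mk, map_add, Eps.im_add]
  · simp only [RingHom.id_apply]
    rw [← Eps.inl_smul, map_smul, Eps.im_smul]; simp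
  · refine Eps.ext (h x) ?_
    conv_lhs => rw [Eps.eq_add_eps_smul (k := k) x, map_add, map_smul, Eps.im_add, Eps.im_smul, h]
    simp [epsLin_apply, add_comm]

theorem exists_eq_epsBilin (L : Eps M →ₗ[DualNumber k] Eps N →ₗ[DualNumber k] Eps P)
    (f : M →ₗ[k] N →ₗ[k] P) (h : ∀ x y, (L x y).re = f x.re y.re) : ∃ g, L = epsBilin f g := by
  refine ⟨LinearMap.mk₂ k (fun x y => (L ⟨x, 0⟩ ⟨y, 0⟩).im) (fun x x' y => ?_) (fun r x y => ?_)
    (fun x y y' => ?_) (fun r x y => ?_), LinearMap.ext₂ fun x y => ?_⟩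
  · rw [Eps.add_mk, map_add, LinearMap.add_apply, Eps.im_add]
  · rw [← Eps.inl_smul, map_smul, LinearMap.smul_apply, Eps.im_smul]; simp
  · rw [Eps.add_mk, map_add, Eps.im_add]
  · rw [← Eps.inl_smul, map_smul, Eps.im_smul]; simp
  · refine Eps.ext (h x y) ?_
    conv_lhs =>
      rw [Eps.eq_add_eps_smul (k := k) x, Eps.eq_add_eps_smul (k := k) y]
    simp only [map_add, map_smul, LinearMap.add_apply, LinearMap.smul_apply, Eps.im_add,
      Eps.im_smul, h]
    simp only [DualNumber.fst_eps, DualNumber.snd_eps, zero_smul, one_smul, zero_add, add_zero,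
      Eps.re_add, Eps.re_smul, h, LinearMap.mk₂_apply, epsBilin_apply]
    abel

/-- The extension of an isomorphism to `k[ε] ⊗ -`. -/
def epsEquiv (e : M ≃ₗ[k] N) : Eps M ≃ₗ[DualNumber k] Eps N where
  toFun x := ⟨e x.re, e x.im⟩
  map_add' x y := Eps.ext (map_add e _ _) (map_add e _ _)
  map_smul' r x := by ext <;> simp
  invFun y := ⟨e.symm y.re, e.symm y.im⟩
  left_inv x := Eps.ext (e.symm_apply_apply _) (e.symm_apply_apply _)
  right_inv y := Eps.ext (e.apply_symm_apply _) (e.apply_symm_apply _)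

/-- Since `ε` is nilpotent, invertibility can be tested modulo `ε`: for `L = f + gε` one solves
first for the constant coefficient and then corrects the coefficient of `ε` by `g`. -/
theorem bijective_of_re (L : Eps M →ₗ[DualNumber k] Eps N) (f : M ≃ₗ[k] N)
    (h : ∀ x, (L x).re = f x.re) : Function.Bijective L := by
  obtain ⟨g, rfl⟩ := exists_eq_epsLin L f.toLinearMap h
  refine ⟨fun x y hxy => ?_, fun y => ⟨⟨f.symm y.re, f.symm (y.im - g (f.symm y.re))⟩, ?_⟩⟩
  · have h1 : x.re = y.re := f.injective (congrArg Eps.re hxy)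
    have h2 : f x.im + g x.re = f y.im + g y.re := congrArg Eps.im hxy
    rw [h1] at h2
    exact Eps.ext h1 (f.injective (add_right_cancel h2))
  · refine Eps.ext (f.apply_symm_apply _) ?_
    change f (f.symm (y.im - g (f.symm y.re))) + g (f.symm y.re) = y.im
    rw [f.apply_symm_apply, sub_add_cancel]

end EpsMaps

/-! ### Stalk complexes and the cocycle of a deformation -/

section Stalks

variable {k : Type w} [CommRing k] {a : Type u} [Category.{v} a] [Preadditive a] [Linear k a]
variable {Z : a} {hZ : Limits.IsZero Z}

theorem stalk_isZero (A : a) {p : ℤ} (h : p ≠ 0) : Limits.IsZero ((stalk A Z hZ).pre.X p) := by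
  change Limits.IsZero (if p = 0 then A else Z)
  rw [if_neg h]; exact hZ

theorem stalk_hom_ext {A : a} {E : Precomplex a} {n : ℤ} {f g : PHom (stalk A Z hZ).pre E n}
    (h : f ⟨0, n, zero_add n⟩ = g ⟨0, n, zero_add n⟩) : f = g := by
  funext ⟨p, q, hpq⟩
  by_cases hp : p = 0
  · subst hp
    obtain rfl : n = q := by omega
    exact h
  · exact (stalk_isZero A hp).eq_of_src _ _

variable (k) in
/-- Graded morphisms of degree `n` out of the stalk complex of `A` are morphisms from `A` to the
component of degree `n`. -/
def evStalk (A : a) (E : Precomplex a) (n : ℤ) :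
    PHom (stalk A Z hZ).pre E n ≃ₗ[k] (A ⟶ E.X n) where
  toFun f := f ⟨0, n, zero_add n⟩
  map_add' _ _ := rfl
  map_smul' _ _ := rfl
  invFun x t := if h : t.p = 0 then
      eqToHom (if_pos h) ≫ x ≫ eqToHom (congrArg E.X (by have := t.hpq; omega)) else 0
  left_inv f := stalk_hom_ext
    ((dif_pos rfl).trans ((Category.id_comp _).trans (Category.comp_id _)))
  right_inv x := (dif_pos rfl).trans ((Category.id_comp _).trans (Category.comp_id x))

theorem evStalk_gcomp {A : a} {E E' : Precomplex a} {p q n : ℤ} (h : p + q = n) (f : PHom E E' p)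
    (x : PHom (stalk A Z hZ).pre E q) :
    evStalk k A E' n (gcomp k h f x) = evStalk k A E q x ≫ f ⟨q, n, by omega⟩ :=
  ext2_apply (compC2 k a) h f x 0 q n _ (zero_add q) _

theorem stalk_hom_eq_zero {A B : a} {n : ℤ} (hn : n ≠ 0)
    (f : PHom (stalk A Z hZ).pre (stalk B Z hZ).pre n) : f = 0 :=
  stalk_hom_ext ((stalk_isZero B hn).eq_of_tgt _ _)

variable {S : Set (ComPlus a)}

/-- The object of a full subcategory given by a stalk complex. -/
def stalkIn (hS : ∀ A : a, stalk A Z hZ ∈ S) (A : a) : S := ⟨stalk A Z hZ, hS A⟩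

variable (hS : ∀ A : a, stalk A Z hZ ∈ S)
  (D : Deformation ((comPlus k a).pull (Subtype.val : S → ComPlus a)))

/-- Morphisms of degree `0` between stalk complexes in a deformation. -/
def stalkEquiv (A B : a) :
    D.quiv.Hom (stalkIn hS A) (stalkIn hS B) 0 ≃ₗ[DualNumber k] Eps (A ⟶ B) :=
  (D.e _ _ 0).trans (epsEquiv (evStalk (hZ := hZ) k A (stalk B Z hZ).pre 0))

/-- This is the source of all vanishing below: between stalks it eliminates differentials,
curvatures and every component of an `A_{[0,∞[}`-morphism except that of arity one. -/
theorem stalk_def_hom_eq_zero {A B : a} {n : ℤ} (hn : n ≠ 0)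
    (f : D.quiv.Hom (stalkIn hS A) (stalkIn hS B) n) : f = 0 :=
  (D.e _ _ n).map_eq_zero_iff.1
    (Eps.ext (stalk_hom_eq_zero (hZ := hZ) hn _) (stalk_hom_eq_zero (hZ := hZ) hn _))

/-- The restriction of the deformation `D` to the stalk complexes is `a_φ[ε]`. -/
def IsCharCocycle (φ : Z2 k a) : Prop :=
  ∀ (A B C : a) (y : D.quiv.Hom (stalkIn hS B) (stalkIn hS C) 0)
    (x : D.quiv.Hom (stalkIn hS A) (stalkIn hS B) 0),
    stalkEquiv hS D A C (D.str.m (add_zero 0) y x) =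
      epsComp φ A B C (stalkEquiv hS D B C y) (stalkEquiv hS D A B x)

/-- The multiplication on degree `0` morphisms between stalks reduces to composition modulo `ε`,
hence has the form `m + φε`. The coefficient of `ε` in its associativity is the cocycle condition.
-/
theorem exists_isCharCocycle : ∃ φ, IsCharCocycle hS D φ := by
  have (A B C : a) : ∃ φ : (B ⟶ C) →ₗ[k] (A ⟶ B) →ₗ[k] (A ⟶ C), ∀ y x,
      stalkEquiv hS D A C (D.str.m (add_zero 0) y x) =
        epsBilin (compC2 k a A B C) φ (stalkEquiv hS D B C y) (stalkEquiv hS D A B x) := by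
    let L : Eps (B ⟶ C) →ₗ[DualNumber k] Eps (A ⟶ B) →ₗ[DualNumber k] Eps (A ⟶ C) :=
      ((D.str.m (add_zero 0)).compl₁₂ (stalkEquiv hS D B C).symm.toLinearMap
        (stalkEquiv hS D A B).symm.toLinearMap).compr₂ (stalkEquiv hS D A C).toLinearMap
    have hL : ∀ y x, stalkEquiv hS D A C (D.str.m (add_zero 0) y x) =
        L (stalkEquiv hS D B C y) (stalkEquiv hS D A B x) := by
      intro y x
      simp [L]
    obtain ⟨φ, hφ⟩ := exists_eq_epsBilin L (compC2 k a A B C) fun y x => by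
      obtain ⟨y, rfl⟩ := (stalkEquiv hS D B C).surjective y
      obtain ⟨x, rfl⟩ := (stalkEquiv hS D A B).surjective x
      rw [← hL]
      refine (congrArg (evStalk (hZ := hZ) k A _ 0) (D.red_m (add_zero 0) y x)).trans ?_
      exact evStalk_gcomp (hZ := hZ) (add_zero 0)
        (show PHom (stalk B Z hZ).pre (stalk C Z hZ).pre 0 from (D.e _ _ 0 y).re) _
    exact ⟨φ, fun y x => by rw [hL, hφ]⟩
  choose φ hφ using this
  refine ⟨⟨φ, fun {A B C E} f g h => ?_⟩, hφ⟩
  let F := (stalkEquiv hS D C E).symm ⟨f, 0⟩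
  let G := (stalkEquiv hS D B C).symm ⟨g, 0⟩
  let H := (stalkEquiv hS D A B).symm ⟨h, 0⟩
  have := congrArg (fun x => (stalkEquiv hS D A E x).im)
    (D.isCDG.assoc (add_zero 0) (add_zero 0) (add_zero _) F G H)
  simp only [hφ, F, G, H, LinearEquiv.apply_symm_apply, epsBilin_apply] at this
  simp only [map_zero, LinearMap.zero_apply, zero_add, add_zero] at this
  change h ≫ φ B C E f g + φ A B E (g ≫ f) h = φ A B C g h ≫ f + φ A C E f (h ≫ g) at this
  rw [← sub_eq_zero] at this
  rw [← this]
  abel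

/-- On degree `0` inputs the component of arity `n` has degree `1 - n`, so only arity one can be
nonzero between stalks. It is then multiplicative and of the form `1 + gε`, and comparing
coefficients of `ε` gives the coboundary of `g`. -/
theorem IsCharCocycle.exists_sub_eq_d1 {D' : Deformation ((comPlus k a).pull Subtype.val)}
    {φ φ' : Z2 k a} (h : IsCharCocycle hS D φ) (h' : IsCharCocycle hS D' φ') (hD : D.Iso D') :
    ∃ g : C1 k a, φ.1 = φ'.1 + d1 k a g := by
  obtain ⟨F, h0, h1, -⟩ := hD
  let F₁ (A B : a) : D.quiv.Hom (stalkIn hS A) (stalkIn hS B) 0 →ₗ[DualNumber k]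
      D'.quiv.Hom (stalkIn hS A) (stalkIn hS B) 0 :=
    { toFun f := F.F (.cons f (.nil _)) 0
      map_add' f g := F.F_add (.nil _) f g (.nil _) 0
      map_smul' x f := F.F_smul (.nil _) x f (.nil _) 0 }
  have hm (A B C : a) (y : D.quiv.Hom (stalkIn hS B) (stalkIn hS C) 0)
      (x : D.quiv.Hom (stalkIn hS A) (stalkIn hS B) 0) :
      F₁ A C (D.str.m (add_zero 0) y x) = D'.str.m (add_zero 0) (F₁ B C y) (F₁ A B x) := by
    have hz {A B : a} (r : Path D.quiv (stalkIn hS A) (stalkIn hS B)) {C E : a} {n : ℤ}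
        (l : Path D.quiv (stalkIn hS C) (stalkIn hS E))
        (f : D.quiv.Hom (stalkIn hS B) (stalkIn hS C) n) (hn : n ≠ 0) (e : ℤ) :
        F.F (l.append (.cons f r)) e = 0 := by
      -- An entry of nonzero degree is zero, and linearity in that entry, applied to the scalar `0`,
      -- kills the value.
      rw [stalk_def_hom_eq_zero hS D hn f, ← zero_smul (DualNumber k) 0, F.F_smul, zero_smul]
    have hz' {A B : a} (p : Path D.quiv (stalkIn hS A) (stalkIn hS B)) {e : ℤ} (he : e ≠ 0) :
        F.F p e = 0 := stalk_def_hom_eq_zero hS D' he _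
    have hmid {p q : ℤ} (hp : p = 0) (hq : q = 0) (hpq : p + q = 0) :
        D'.str.m hpq (F.F (.cons y (.nil _)) p) (F.F (.cons x (.nil _)) q) =
          D'.str.m (add_zero 0) (F₁ B C y) (F₁ A B x) := by
      subst hp hq; rfl
    have z₁ : F.F (.cons (D.str.c (stalkIn hS C)) (.cons y (.cons x (.nil _)))) 0 = 0 :=
      hz (.cons y (.cons x (.nil _))) (.nil (stalkIn hS C)) (D.str.c _) (by norm_num) 0
    have z₂ : F.F (.cons y (.cons (D.str.c (stalkIn hS B)) (.cons x (.nil _)))) 0 = 0 :=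
      hz (.cons x (.nil _)) (.cons y (.nil _)) _ (by norm_num) 0
    have z₃ : F.F (.cons y (.cons x (.cons (D.str.c (stalkIn hS A)) (.nil _)))) 0 = 0 :=
      hz (.nil _) (.cons y (.cons x (.nil _))) _ (by norm_num) 0
    have z₄ : F.F (.cons (D.str.d rfl y) (.cons x (.nil _))) 0 = 0 :=
      hz (.cons x (.nil _)) (.nil (stalkIn hS C)) (D.str.d rfl y) (by norm_num) 0
    have z₅ : F.F (.cons y (.cons (D.str.d rfl x) (.nil _))) 0 = 0 :=
      hz (.nil _) (.cons y (.nil _)) _ (by norm_num) 0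
    -- Two entries of degree `0` have shifted degree `-2`, so the arity two component lies in degree
    -- `-1` and the equation in degree `0`.
    have := F.eq_cons y (.cons x (.nil _)) (-1) 0 (by simp [Path.sdeg]) (by norm_num)
    simp only [Path.sumSplit, Path.sumInsert, Path.contractFirst] at this
    rw [hz' (.cons y (.cons x (.nil _))) (show (-1 : ℤ) ≠ 0 by norm_num),
      hz' (.nil (stalkIn hS C)) (by simp [Path.sdeg]),
      hz' (.nil (stalkIn hS A)) (by simp [Path.sdeg]),
      hmid (by simp [Path.sdeg]) (by simp [Path.sdeg]), z₁, z₂, z₃, z₄, z₅] at this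
    simp [Path.sdeg] at this
    exact this.symm
  have (A B : a) : ∃ g : (A ⟶ B) →ₗ[k] (A ⟶ B), ∀ x,
      stalkEquiv hS D' A B (F₁ A B x) = epsLin LinearMap.id g (stalkEquiv hS D A B x) := by
    let L : Eps (A ⟶ B) →ₗ[DualNumber k] Eps (A ⟶ B) :=
      (stalkEquiv hS D' A B).toLinearMap ∘ₗ F₁ A B ∘ₗ (stalkEquiv hS D A B).symm.toLinearMap
    have hL x : stalkEquiv hS D' A B (F₁ A B x) = L (stalkEquiv hS D A B x) := by simp [L]
    obtain ⟨g, hg⟩ := exists_eq_epsLin L LinearMap.id fun x => by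
      obtain ⟨x, rfl⟩ := (stalkEquiv hS D A B).surjective x
      rw [← hL]
      exact congrArg (evStalk (hZ := hZ) k A _ 0) (h1 x)
    exact ⟨g, fun x => by rw [hL, hg]⟩
  choose g hg using this
  refine ⟨g, C2.ext fun A B C f e => ?_⟩
  have := hm A B C ((stalkEquiv hS D B C).symm ⟨f, 0⟩) ((stalkEquiv hS D A B).symm ⟨e, 0⟩)
  replace this := congrArg (fun x => (stalkEquiv hS D' A C x).im) this
  simp only [hg, h' _ _ _ _ _, h _ _ _ _ _, LinearEquiv.apply_symm_apply] at this
  change 0 ≫ f + e ≫ 0 + φ.1 A B C f e + g A C (e ≫ f) =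
    (0 + g A B e) ≫ f + e ≫ (0 + g B C f) + φ'.1 A B C f e at this
  change _ = _ + (e ≫ g B C f - g A C (e ≫ f) + g A B e ≫ f)
  simp only [zero_add, Limits.zero_comp, Limits.comp_zero] at this
  rw [← sub_eq_zero] at this ⊢
  rw [← this]
  abel

end Stalks
-- Reconstructing a deformation from its stalk complexes
section Reconstruction

variable {k : Type w} [CommRing k] {a : Type u} [Category.{v} a] [Preadditive a] [Linear k a]
variable {Z : a} {hZ : Limits.IsZero Z} {S : Set (ComPlus a)}
variable (hS : ∀ A : a, stalk A Z hZ ∈ S)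
  (D : Deformation ((comPlus k a).pull (Subtype.val : S → ComPlus a)))

/-- Morphisms out of a stalk complex in a deformation. -/
def evDef (A : a) (C : S) (n : ℤ) :
    D.quiv.Hom (stalkIn hS A) C n ≃ₗ[DualNumber k] Eps (A ⟶ C.1.pre.X n) :=
  (D.e _ _ n).trans (epsEquiv (evStalk (hZ := hZ) k A C.1.pre n))

theorem evDef_m_re {A : a} {C E : S} {p q n : ℤ} (h : p + q = n) (f : D.quiv.Hom C E p)
    (x : D.quiv.Hom (stalkIn hS A) C q) :
    (evDef hS D A E n (D.str.m h f x)).re = (evDef hS D A C q x).re ≫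
      (show PHom C.1.pre E.1.pre p from (D.e C E p f).re) ⟨q, n, by omega⟩ :=
  (congrArg (evStalk (hZ := hZ) k A _ n) (D.red_m h f x)).trans
    (evStalk_gcomp (hZ := hZ) h (show PHom C.1.pre E.1.pre p from (D.e C E p f).re) _)

/-- The inclusion of the stalk complex of `C^p` in `C`, as a graded morphism of degree `p`. -/
def stalkIncl (C : S) (p : ℤ) : D.quiv.Hom (stalkIn hS (C.1.pre.X p)) C p :=
  (evDef hS D _ C p).symm ⟨𝟙 _, 0⟩

theorem evDef_stalkIncl (C : S) (p : ℤ) : evDef hS D _ C p (stalkIncl hS D C p) = ⟨𝟙 _, 0⟩ :=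
  LinearEquiv.apply_symm_apply _ _

theorem evDef_m_stalkIncl_re {C E : S} {p q n : ℤ} (h : p + q = n) (f : D.quiv.Hom C E p) :
    (evDef hS D _ E n (D.str.m h f (stalkIncl hS D C q))).re =
      (show PHom C.1.pre E.1.pre p from (D.e C E p f).re) ⟨q, n, by omega⟩ := by
  rw [evDef_m_re, evDef_stalkIncl]
  exact Category.id_comp _

/-- Composition with `stalkIncl`. -/
def inclMap (A : a) (C : S) (p : ℤ) :
    Eps (A ⟶ C.1.pre.X p) →ₗ[DualNumber k] D.quiv.Hom (stalkIn hS A) C p :=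
  D.str.m (add_zero p) (stalkIncl hS D C p) ∘ₗ (stalkEquiv hS D A (C.1.pre.X p)).symm.toLinearMap

theorem evDef_inclMap_re {A : a} {C : S} {p : ℤ} (x : Eps (A ⟶ C.1.pre.X p)) :
    (evDef hS D A C p (inclMap hS D A C p x)).re = x.re := by
  refine (evDef_m_re hS D (add_zero p) _ _).trans ?_
  have h₁ : (evDef hS D A _ 0 ((stalkEquiv hS D A (C.1.pre.X p)).symm x)).re = x.re :=
    congrArg Eps.re ((stalkEquiv hS D A (C.1.pre.X p)).apply_symm_apply x)
  have h₂ := congrArg Eps.re (evDef_stalkIncl hS D C p)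
  exact (congr_arg₂ _ h₁ h₂).trans (Category.comp_id _)

/-- Every morphism from a stalk complex to `C` factors uniquely through `stalkIncl`. -/
noncomputable def inclEquiv (A : a) (C : S) (p : ℤ) :
    Eps (A ⟶ C.1.pre.X p) ≃ₗ[DualNumber k] D.quiv.Hom (stalkIn hS A) C p :=
  LinearEquiv.ofBijective (inclMap hS D A C p) <| by
    -- Modulo `ε`, composing with the inclusion of `C^p` and evaluating in degree `0` is the
    -- identity.
    have := bijective_of_re ((evDef hS D A C p).toLinearMap ∘ₗ inclMap hS D A C p)
      (LinearEquiv.refl k _) fun x => evDef_inclMap_re hS D x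
    exact ((evDef hS D A C p).bijective.of_comp_iff' _).1 this

theorem inclEquiv_apply {A : a} {C : S} {p : ℤ} (x : Eps (A ⟶ C.1.pre.X p)) :
    inclEquiv hS D A C p x =
      D.str.m (add_zero p) (stalkIncl hS D C p) ((stalkEquiv hS D A (C.1.pre.X p)).symm x) := rfl

theorem evDef_inclEquiv_symm_re {A : a} {C : S} {p : ℤ} (x : D.quiv.Hom (stalkIn hS A) C p) :
    ((inclEquiv hS D A C p).symm x).re = (evDef hS D A C p x).re := by
  obtain ⟨x, rfl⟩ := (inclEquiv hS D A C p).surjective x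
  rw [LinearEquiv.symm_apply_apply]
  exact (evDef_inclMap_re hS D x).symm

variable {hS D} {φ : Z2 k a}

/-- Associativity moves the product onto the two morphisms between stalks, where it is composition
in `a_φ[ε]`. Thus `inclEquiv` is natural in the stalk. -/
theorem inclEquiv_m (hφ : IsCharCocycle hS D φ) {A B : a} {C : S} {p : ℤ}
    (y : Eps (B ⟶ C.1.pre.X p)) (x : Eps (A ⟶ B)) :
    D.str.m (add_zero p) (inclEquiv hS D B C p y) ((stalkEquiv hS D A B).symm x) =
      inclEquiv hS D A C p (epsComp φ A B _ y x) := by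
  rw [inclEquiv_apply, inclEquiv_apply, D.isCDG.assoc (add_zero p) (add_zero 0) (by omega)]
  congr 1
  rw [LinearEquiv.eq_symm_apply, hφ, LinearEquiv.apply_symm_apply, LinearEquiv.apply_symm_apply]

variable (hS D)

/-- The components of the graded morphism over `a_φ[ε]` determined by a morphism of `D`. -/
noncomputable def rectifyAt {C E : S} {p q n : ℤ} (h : p + n = q) :
    D.quiv.Hom C E n →ₗ[DualNumber k] Eps (C.1.pre.X p ⟶ E.1.pre.X q) :=
  (inclEquiv hS D (C.1.pre.X p) E q).symm.toLinearMap ∘ₗ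
    (D.str.m (show n + p = q by omega)).flip (stalkIncl hS D C p)

/-- The differential over `a_φ[ε]` determined by the deformation. -/
noncomputable def rectifyDiff (C : S) {p q : ℤ} (h : p + 1 = q) :
    Eps (C.1.pre.X p ⟶ C.1.pre.X q) :=
  (inclEquiv hS D (C.1.pre.X p) C q).symm (D.str.d h (stalkIncl hS D C p))

theorem rectifyAt_re {C E : S} {n : ℤ} (f : D.quiv.Hom C E n) (t : Triplet n) :
    (rectifyAt hS D t.hpq f).re = (show PHom C.1.pre E.1.pre n from (D.e C E n f).re) t :=
  (evDef_inclEquiv_symm_re hS D _).trans (evDef_m_stalkIncl_re hS D _ f)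

/-- Modulo `ε` the differential of the inclusion `ι` of a component is `δ ι`, because the other term
contains the zero differential of the stalk. -/
theorem rectifyDiff_re (C : S) (t : Triplet 1) :
    (rectifyDiff hS D C t.hpq).re = C.1.pre.δ t := by
  refine (evDef_inclEquiv_symm_re hS D _).trans ?_
  let ι : PHom (stalk (C.1.pre.X t.p) Z hZ).pre C.1.pre t.p := (D.e _ _ _ (stalkIncl hS D C t.p)).re
  have h₁ : evStalk (hZ := hZ) k _ C.1.pre t.p ι = 𝟙 _ :=
    congrArg Eps.re (evDef_stalkIncl hS D C t.p)
  have h₂ : gcomp k (show 1 + t.p = t.q by have := t.hpq; omega) C.1.pre.δ ι -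
      t.p.negOnePow • gcomp k t.hpq ι (0 : PHom (stalk (C.1.pre.X t.p) Z hZ).pre _ 1) =
        gcomp k (show 1 + t.p = t.q by have := t.hpq; omega) C.1.pre.δ ι := by
    rw [map_zero, smul_zero, sub_zero]
  refine (congrArg (evStalk (hZ := hZ) k _ _ _)
    ((D.red_d t.hpq (stalkIncl hS D C t.p)).trans h₂)).trans ?_
  refine (evStalk_gcomp (hZ := hZ) _ C.1.pre.δ ι).trans ?_
  rw [h₁]
  exact Category.id_comp _

variable {hS D}

theorem inclEquiv_rectifyAt {C E : S} {p q n : ℤ} (h : p + n = q) (f : D.quiv.Hom C E n) :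
    inclEquiv hS D _ E q (rectifyAt hS D h f) =
      D.str.m (show n + p = q by omega) f (stalkIncl hS D C p) :=
  (inclEquiv hS D _ E q).apply_symm_apply _

theorem inclEquiv_rectifyDiff (C : S) {p q : ℤ} (h : p + 1 = q) :
    inclEquiv hS D _ C q (rectifyDiff hS D C h) = D.str.d h (stalkIncl hS D C p) :=
  (inclEquiv hS D _ C q).apply_symm_apply _

theorem m_inclEquiv (hφ : IsCharCocycle hS D φ) {A : a} {C E : S} {p q n : ℤ} (h : n + p = q)
    (f : D.quiv.Hom C E n) (x : Eps (A ⟶ C.1.pre.X p)) :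
    D.str.m h f (inclEquiv hS D A C p x) =
      inclEquiv hS D A E q (epsComp φ _ _ _ (rectifyAt hS D (show p + n = q by omega) f) x) := by
  rw [inclEquiv_apply, ← D.isCDG.assoc h (add_zero p) (by omega), ← inclEquiv_m hφ,
    inclEquiv_rectifyAt]

/-- By the Leibniz rule only the differential of the inclusion contributes, as the degree `1`
differential of a morphism between stalks is zero. Hence `d` acts as composition with `rectifyDiff`.
-/
theorem d_inclEquiv (hφ : IsCharCocycle hS D φ) {A : a} {C : S} {p q : ℤ} (h : p + 1 = q)
    (x : Eps (A ⟶ C.1.pre.X p)) :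
    D.str.d h (inclEquiv hS D A C p x) =
      inclEquiv hS D A C q (epsComp φ _ _ _ (rectifyDiff hS D C h) x) := by
  rw [inclEquiv_apply, D.isCDG.leibniz (add_zero p) h (zero_add 1) h,
    stalk_def_hom_eq_zero hS D one_ne_zero (D.str.d _ _), map_zero, smul_zero, add_zero,
    ← inclEquiv_m hφ, inclEquiv_rectifyDiff]

theorem rectifyAt_m (hφ : IsCharCocycle hS D φ) {B C E : S} {p q n i l j : ℤ} (h : p + q = n)
    (hij : i + n = j) (hil : i + q = l) (hlj : l + p = j)
    (f : D.quiv.Hom C E p) (g : D.quiv.Hom B C q) :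
    rectifyAt hS D hij (D.str.m h f g) =
      epsComp φ _ _ _ (rectifyAt hS D hlj f) (rectifyAt hS D hil g) := by
  apply (inclEquiv hS D _ E j).injective
  rw [inclEquiv_rectifyAt, D.isCDG.assoc h (show q + i = l by omega) (by omega),
    ← m_inclEquiv hφ (show p + l = j by omega), inclEquiv_rectifyAt]

/-- This is the Leibniz rule for `f` times the inclusion of `C^i`, solved for the term with `d f`
and translated through `inclEquiv`. -/
theorem rectifyAt_d (hφ : IsCharCocycle hS D φ) {C E : S} {p q i l l' j : ℤ} (h : p + 1 = q)
    (hij : i + q = j) (hil : i + p = l) (hlj : l + 1 = j) (hil' : i + 1 = l') (hlj' : l' + p = j)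
    (f : D.quiv.Hom C E p) :
    rectifyAt hS D hij (D.str.d h f) =
      epsComp φ _ _ _ (rectifyDiff hS D E hlj) (rectifyAt hS D hil f) -
        p.negOnePow • epsComp φ _ _ _ (rectifyAt hS D hlj' f) (rectifyDiff hS D C hil') := by
  apply (inclEquiv hS D _ E j).injective
  have := D.isCDG.leibniz (show p + i = l by omega) h hil' hlj f (stalkIncl hS D C i)
  rw [← inclEquiv_rectifyAt hil, ← inclEquiv_rectifyDiff, d_inclEquiv hφ,
    m_inclEquiv hφ, ← inclEquiv_rectifyAt hij] at this
  rw [Units.smul_def, map_sub, map_zsmul, ← Units.smul_def, this, add_sub_cancel_right]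

/-- Apply `d² = -[c, -]` to the inclusion of `C^i`. The curvature of the stalk vanishes by degree,
so the curvature of `C` is minus the square of the reconstructed differential. -/
theorem rectifyAt_c (hφ : IsCharCocycle hS D φ) (C : S) {i l j : ℤ} (hij : i + 2 = j)
    (hil : i + 1 = l) (hlj : l + 1 = j) :
    rectifyAt hS D hij (D.str.c C) =
      -epsComp φ _ _ _ (rectifyDiff hS D C hlj) (rectifyDiff hS D C hil) := by
  apply (inclEquiv hS D _ C j).injective
  have := D.isCDG.d_d hil hlj (stalkIncl hS D C i)
  rw [stalk_def_hom_eq_zero hS D two_ne_zero (D.str.c (stalkIn hS _)), map_zero, sub_zero,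
    ← inclEquiv_rectifyDiff, d_inclEquiv hφ, ← inclEquiv_rectifyAt hij] at this
  rw [map_neg, this, neg_neg]

variable (hS D)

/-- The part with coefficient `ε` of the differential determined by the deformation. -/
noncomputable def rectifyDiffIm (C : S) : PHom C.1.pre C.1.pre 1 :=
  fun t => (rectifyDiff hS D C t.hpq).im

variable (φ) in
/-- The graded morphism over `a_φ[ε]` determined by a morphism of `D`. -/
noncomputable def rectify (C E : S) (n : ℤ) : D.quiv.Hom C E n →ₗ[DualNumber k]
    PHom (C.1.pre.lift φ (rectifyDiffIm hS D C)) (E.1.pre.lift φ (rectifyDiffIm hS D E)) n :=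
  LinearMap.pi fun t => rectifyAt hS D t.hpq

theorem lift_rectifyDiff_δ (C : S) {p q : ℤ} (h : p + 1 = q) :
    (C.1.pre.lift φ (rectifyDiffIm hS D C)).δ ⟨p, q, h⟩ = rectifyDiff hS D C h :=
  Eps.ext (rectifyDiff_re hS D C ⟨p, q, h⟩).symm rfl

variable {hS D}

theorem rectify_m (hφ : IsCharCocycle hS D φ) {B C E : S} {p q n : ℤ} (h : p + q = n)
    (f : D.quiv.Hom C E p) (g : D.quiv.Hom B C q) :
    rectify hS D φ B E n (D.str.m h f g) =
      gcomp (DualNumber k) h (rectify hS D φ C E p f) (rectify hS D φ B C q g) :=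
  funext fun t => rectifyAt_m hφ h t.hpq rfl (by have := t.hpq; omega) f g

theorem rectify_d (hφ : IsCharCocycle hS D φ) {C E : S} {p q : ℤ} (h : p + 1 = q)
    (f : D.quiv.Hom C E p) :
    rectify hS D φ C E q (D.str.d h f) =
      gcomp (DualNumber k) (show 1 + p = q by omega)
          (E.1.pre.lift φ (rectifyDiffIm hS D E)).δ (rectify hS D φ C E p f) -
        p.negOnePow • gcomp (DualNumber k) h (rectify hS D φ C E p f)
          (C.1.pre.lift φ (rectifyDiffIm hS D C)).δ := by
  funext ⟨i, j, hij⟩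
  have e₁ := lift_rectifyDiff_δ hS D (φ := φ) E (show i + p + 1 = j by omega)
  have e₂ := lift_rectifyDiff_δ hS D (φ := φ) C (rfl : i + 1 = i + 1)
  refine (rectifyAt_d hφ h hij rfl (show i + p + 1 = j by omega) rfl (by omega) f).trans ?_
  rw [← e₁, ← e₂]
  rfl

theorem rectify_c (hφ : IsCharCocycle hS D φ) (C : S) :
    rectify hS D φ C C 2 (D.str.c C) = -gcomp (DualNumber k) (show (1 : ℤ) + 1 = 2 by norm_num)
      (C.1.pre.lift φ (rectifyDiffIm hS D C)).δ (C.1.pre.lift φ (rectifyDiffIm hS D C)).δ := by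
  funext ⟨i, j, hij⟩
  have e₁ := lift_rectifyDiff_δ hS D (φ := φ) C (show i + 1 + 1 = j by omega)
  have e₂ := lift_rectifyDiff_δ hS D (φ := φ) C (rfl : i + 1 = i + 1)
  refine (rectifyAt_c hφ C hij rfl (by omega)).trans ?_
  rw [← e₁, ← e₂]
  rfl

/-- A deformation of a full subcategory containing the stalk complexes is isomorphic to the one
spanned by lifts over its restriction to the stalk complexes. -/
theorem IsCharCocycle.curvedIso_spanLift (hφ : IsCharCocycle hS D φ) :
    D.CurvedIso (spanLift φ (fun C : S => C.1.pre) (rectifyDiffIm hS D)) := by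
  refine ⟨⟨fun _ => 0, rectify hS D φ, fun A => ?_, fun h f => ?_,
    fun h f g => rectify_m hφ h f g⟩, fun A => ?_, fun f => ?_⟩
  · rw [map_zero, map_zero, sub_zero, sub_zero]
    exact (rectify_c hφ A).symm
  · rw [map_zero, map_zero, smul_zero, sub_zero, LinearMap.zero_apply, add_zero]
    exact rectify_d hφ h f
  · rw [map_zero, Eps.re_zero]
  · exact funext fun t => rectifyAt_re hS D f t

/-- Zero curvature makes the reconstructed differential `δ + hε` square to zero in `a_φ[ε]`. The
coefficient of `ε` says that `h` trivializes the obstruction `-φ(δ, δ)`. -/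
theorem IsCharCocycle.subset_phiInf (hφ : IsCharCocycle hS D φ) (hD : D.IsDG) : S ⊆ phiInf φ := by
  intro C hC
  let C' : S := ⟨C, hC⟩
  refine ⟨rectifyDiffIm hS D C', ?_⟩
  funext ⟨i, j, hij⟩
  have h := rectifyAt_c hφ C' hij rfl (show i + 1 + 1 = j by omega)
  rw [hD, map_zero, ← lift_rectifyDiff_δ hS D (φ := φ), ← lift_rectifyDiff_δ hS D (φ := φ)] at h
  replace h := congrArg Eps.im h
  let d1 := C.pre.δ ⟨i, i + 1, rfl⟩
  let d2 := C.pre.δ ⟨i + 1, j, by omega⟩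
  let γ1 := rectifyDiffIm hS D C' ⟨i, i + 1, rfl⟩
  let γ2 := rectifyDiffIm hS D C' ⟨i + 1, j, by omega⟩
  change 0 = -(γ1 ≫ d2 + d1 ≫ γ2 + φ.1 _ _ _ d2 d1) at h
  change γ1 ≫ d2 - Int.negOnePow 1 • d1 ≫ γ2 = -φ.1 _ _ _ d2 d1
  rw [Int.negOnePow_one, Units.neg_smul, one_smul, sub_neg_eq_add]
  exact eq_neg_of_add_eq_zero_left (neg_eq_zero.1 h.symm)

end Reconstruction
-- Maximality, injectivity and the image of `ρ`
section Maximal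

variable {k : Type w} [CommRing k] {a : Type u} [Category.{v} a] [Preadditive a] [Linear k a]

theorem HH2.mk_eq_mk_iff {φ φ' : Z2 k a} :
    HH2.mk φ = HH2.mk φ' ↔ ∃ g : C1 k a, φ.1 = φ'.1 + d1 k a g := by
  refine (Submodule.Quotient.eq _).trans ?_
  simp only [Submodule.submoduleOf, Submodule.mem_comap, LinearMap.mem_range]
  exact exists_congr fun g => eq_comm.trans sub_eq_iff_eq_add'

theorem stalk_mem_phiInf (φ : Z2 k a) (A Z : a) (hZ : Limits.IsZero Z) :
    stalk A Z hZ ∈ phiInf φ := by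
  refine ⟨0, (map_zero _).trans ?_⟩
  change (0 : PHom (stalk A Z hZ).pre (stalk A Z hZ).pre 2) =
    -ext2 φ.1 _ (0 : PHom (stalk A Z hZ).pre (stalk A Z hZ).pre 1) 0
  rw [map_zero, neg_zero]

section

variable {Z : a} {hZ : Limits.IsZero Z} {S : Set (ComPlus a)} (hS : ∀ A : a, stalk A Z hZ ∈ S)

theorem isCharCocycle_spanLift (φ : Z2 k a) (δ : ∀ C : S, PHom C.1.pre C.1.pre 1) :
    IsCharCocycle hS (spanLift φ (fun C : S => C.1.pre) δ) φ :=
  fun _ _ _ _ _ => rfl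

variable {hS} in
theorem IsCharCocycle.of_coincide {φ : Z2 k a}
    {D D' : Deformation ((comPlus k a).pull (Subtype.val : S → ComPlus a))}
    (h : IsCharCocycle hS D' φ) (hD : D.Coincide D') : IsCharCocycle hS D φ := by
  intro A B C y x
  have h₁ := h A B C ((D'.e _ _ 0).symm (D.e _ _ 0 y)) ((D'.e _ _ 0).symm (D.e _ _ 0 x))
  have h₂ := hD.1 (add_zero 0) (D.e _ _ 0 y) (D.e _ _ 0 x)
  rw [LinearEquiv.symm_apply_apply, LinearEquiv.symm_apply_apply] at h₂
  simp only [stalkEquiv, LinearEquiv.trans_apply, LinearEquiv.apply_symm_apply] at h₁ ⊢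
  rw [h₂, h₁]

theorem isCharCocycle_embrDeformation (φ : Z2 k a) (δ : ∀ C : S, PHom C.1.pre C.1.pre 1) :
    IsCharCocycle hS (embrDeformation φ (fun C : S => C.1.pre) δ) φ :=
  (isCharCocycle_spanLift hS φ δ).of_coincide (embrDeformation_coincide φ _ δ)

end

/-- This makes stalk complexes available for the maximality statements, which do not assume a zero
object: any extra object `C` supplies one. -/
theorem ComPlus.exists_isZero (C : ComPlus a) : ∃ Z : a, Limits.IsZero Z := by
  obtain ⟨n, hn⟩ := C.2.2
  exact ⟨_, hn (n - 1) (by omega)⟩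

/-- An extension `P'` of `P` contains the stalks and has some cocycle `φ'` there, cohomologous to
`φ` because `P` is isomorphic to a restriction of `P'`. As `P'` is dg, its objects lie in `phiInf
φ'`, which is contained in `phiInf φ`. -/
theorem isMaximal_of_isCharCocycle {φ : Z2 k a} (P : PartialDG (comPlus k a))
    (hP : P.S = phiInf φ)
    (h : ∀ (Z : a) (hZ : Limits.IsZero Z) (hS : ∀ A : a, stalk A Z hZ ∈ P.S),
      IsCharCocycle hS P.D φ) : P.IsMaximal := by
  rintro P' ⟨hsub, hiso⟩
  refine Set.Subset.antisymm (fun C hC => ?_) hsub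
  obtain ⟨Z, hZ⟩ := C.exists_isZero
  have hS (A : a) : stalk A Z hZ ∈ P.S := hP ▸ stalk_mem_phiInf φ A Z hZ
  have hS' (A : a) : stalk A Z hZ ∈ P'.S := hsub (hS A)
  obtain ⟨φ', hφ'⟩ := exists_isCharCocycle hS' P'.D
  have hφ'' : IsCharCocycle hS (P'.restrict hsub) φ' := hφ'
  have hmk := HH2.mk_eq_mk_iff.2 ((h Z hZ hS).exists_sub_eq_d1 hS _ hφ'' hiso)
  -- Passing through cohomology classes reverses the roles of `φ` and `φ'`, as the inclusion needed
  -- goes from `phiInf φ'` to `phiInf φ`.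
  obtain ⟨g, hg⟩ := HH2.mk_eq_mk_iff.1 hmk.symm
  rw [hP]
  exact phiInf_subset hg (hφ'.subset_phiInf P'.isDG hC)

theorem embrPartial_isMaximal (φ : Z2 k a) (h : ∀ C : phiInf φ, PHom C.1.pre C.1.pre 1)
    (hh : ∀ C : phiInf φ,
      (pcom k a).d (show (1 : ℤ) + 1 = 2 by norm_num) (h C) = (embr φ.1).c C.1.pre) :
    (embrPartial φ h hh).IsMaximal :=
  isMaximal_of_isCharCocycle _ rfl fun _ _ hS => isCharCocycle_embrDeformation hS φ h

theorem comSpan_D_eq_spanLift (φ : Z2 k a)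
    (Γ : ∀ C : phiInf φ, {C' : Precomplex (DefCat φ) // C'.red = C.1.pre ∧ C'.IsComplex}) :
    ∃ δ, (comSpan φ Γ).D = spanLift φ (fun C : phiInf φ => C.1.pre) δ :=
  spanDeformation_eq_spanLift _ _ _

theorem comSpan_isMaximal (φ : Z2 k a)
    (Γ : ∀ C : phiInf φ, {C' : Precomplex (DefCat φ) // C'.red = C.1.pre ∧ C'.IsComplex}) :
    (comSpan φ Γ).IsMaximal := by
  refine isMaximal_of_isCharCocycle _ rfl fun Z hZ hS => ?_
  obtain ⟨δ, hδ⟩ := comSpan_D_eq_spanLift φ Γ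
  rw [hδ]
  exact isCharCocycle_spanLift hS φ δ

/-- This serves twice: with `S` all of `phiInf φ'` it shows that `Γ`-spans represent `ρ'`, and with
`S` the objects of an arbitrary maximal deformation it gives the morphism to which maximality is
applied. -/
theorem iso_restrict_embrPartial {φ φ' : Z2 k a} (hφ : HH2.mk φ = HH2.mk φ')
    {S : Set (ComPlus a)} {D : Deformation ((comPlus k a).pull (Subtype.val : S → ComPlus a))}
    {δ : ∀ C : S, PHom C.1.pre C.1.pre 1}
    (hD : D.CurvedIso (spanLift φ (fun C : S => C.1.pre) δ))
    (h : ∀ C : phiInf φ', PHom C.1.pre C.1.pre 1)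
    (hh : ∀ C : phiInf φ',
      (pcom k a).d (show (1 : ℤ) + 1 = 2 by norm_num) (h C) = (embr φ'.1).c C.1.pre)
    (hS : S ⊆ phiInf φ') : D.Iso ((embrPartial φ' h hh).restrict hS) := by
  obtain ⟨g, hg⟩ := HH2.mk_eq_mk_iff.1 hφ
  have h₁ := hD.trans (spanLift_curvedIso hg _ δ fun C => h (Set.inclusion hS C))
  exact (h₁.trans (embrDeformation_coincide φ' _ _).symm.curvedIso).iso

theorem phiInf_eq {φ φ' : Z2 k a} (hφ : HH2.mk φ = HH2.mk φ') : phiInf φ = phiInf φ' := by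
  obtain ⟨g, hg⟩ := HH2.mk_eq_mk_iff.1 hφ
  obtain ⟨g', hg'⟩ := HH2.mk_eq_mk_iff.1 hφ.symm
  exact (phiInf_subset hg).antisymm (phiInf_subset hg')

theorem mk_quotient_out (x : HH2 k a) : HH2.mk (Quotient.out x) = x :=
  Quotient.out_eq x

theorem mk_comSpan (φ : Z2 k a)
    (Γ : ∀ C : phiInf φ, {C' : Precomplex (DefCat φ) // C'.red = C.1.pre ∧ C'.IsComplex}) :
    PartialDG.Sk.mk (comSpan φ Γ) = rhoPrime (HH2.mk φ) := by
  have hφ := (mk_quotient_out (HH2.mk φ)).symm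
  obtain ⟨δ, hδ⟩ := comSpan_D_eq_spanLift φ Γ
  refine Quot.sound ⟨phiInf_eq hφ, iso_restrict_embrPartial (δ := δ) hφ ?_ _ _ _⟩
  rw [hδ]
  exact Deformation.Coincide.curvedIso
    ⟨fun _ _ _ => rfl, fun _ _ => rfl, fun _ => rfl⟩

/-- The maximal partial deformation determined by a cohomology class. -/
noncomputable def rhoMax (x : HH2 k a) : PartialDG.SkMax (comPlus k a) :=
  PartialDG.SkMax.mk (embrPartial (Quotient.out x) (fun C => Classical.choose C.2)
    (fun C => Classical.choose_spec C.2)) (embrPartial_isMaximal _ _ _)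

open Classical in
/-- The class of the restriction to the stalk complexes, if these belong to the partial
deformation. -/
noncomputable def charClass (Z : a) (hZ : Limits.IsZero Z) (P : PartialDG (comPlus k a)) :
    HH2 k a :=
  if hS : ∀ A : a, stalk A Z hZ ∈ P.S then
    HH2.mk (Classical.choose (exists_isCharCocycle hS P.D)) else 0

/-- The cocycle chosen in `charClass` and the given `φ` belong to the same deformation, so
invariance under the self-isomorphism `hP` makes them cohomologous. -/
theorem charClass_eq {Z : a} {hZ : Limits.IsZero Z} {P : PartialDG (comPlus k a)}
    {hS : ∀ A : a, stalk A Z hZ ∈ P.S} {φ : Z2 k a} (h : IsCharCocycle hS P.D φ)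
    (hP : P.D.Iso P.D) : charClass Z hZ P = HH2.mk φ := by
  rw [charClass, dif_pos hS]
  exact HH2.mk_eq_mk_iff.2 ((Classical.choose_spec (exists_isCharCocycle hS P.D)).exists_sub_eq_d1
    hS _ h hP)

theorem charClass_congr {Z : a} {hZ : Limits.IsZero Z} {P P' : PartialDG (comPlus k a)}
    (h : P.Iso P') : charClass Z hZ P = charClass Z hZ P' := by
  obtain ⟨hPP', hiso⟩ := h
  by_cases hS : ∀ A : a, stalk A Z hZ ∈ P.S
  · have hS' : ∀ A : a, stalk A Z hZ ∈ P'.S := fun A => hPP' ▸ hS A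
    rw [charClass, charClass, dif_pos hS, dif_pos hS']
    exact HH2.mk_eq_mk_iff.2
      ((Classical.choose_spec (exists_isCharCocycle hS P.D)).exists_sub_eq_d1 hS _
        (D' := P'.restrict hPP'.subset)
        (Classical.choose_spec (exists_isCharCocycle hS' P'.D)) hiso)
  · have hS' : ¬∀ A : a, stalk A Z hZ ∈ P'.S := hPP' ▸ hS
    rw [charClass, charClass, dif_neg hS, dif_neg hS']

theorem Deformation.Iso.refl {T : Type u} {Q : GrQuiver.{w, v} k T} {μ : Cochain2 Q}
    (D : Deformation μ) : D.Iso D :=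
  (Coincide.curvedIso ⟨fun _ _ _ => rfl, fun _ _ => rfl, fun _ => rfl⟩).iso

theorem rhoMax_injective (Z : a) (hZ : Limits.IsZero Z) :
    Function.Injective (rhoMax (k := k) (a := a)) := by
  let c : PartialDG.SkMax (comPlus k a) → HH2 k a :=
    Quot.lift (fun P => charClass Z hZ P.1) fun _ _ h => charClass_congr h
  -- Restriction to the stalks is a left inverse, since the embedded deformation of `φ` restricts to
  -- `a_φ[ε]`.
  refine Function.LeftInverse.injective (g := c) fun x => ?_
  have hS := fun A => stalk_mem_phiInf (Quotient.out x) A Z hZ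
  exact (charClass_eq (isCharCocycle_embrDeformation hS (Quotient.out x) _)
    (Deformation.Iso.refl _)).trans (mk_quotient_out x)

theorem range_rhoMax (Z : a) (hZ : Limits.IsZero Z) :
    Set.range (rhoMax (k := k) (a := a)) = {ξ | ∃ (P : PartialDG (comPlus k a)) (hP : P.IsMaximal),
      (∀ A : a, stalk A Z hZ ∈ P.S) ∧ PartialDG.SkMax.mk P hP = ξ} := by
  refine Set.Subset.antisymm ?_ ?_
  · rintro _ ⟨x, rfl⟩
    exact ⟨_, embrPartial_isMaximal _ _ _, fun A => stalk_mem_phiInf _ A Z hZ, rfl⟩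
  · rintro _ ⟨P, hP, hS, rfl⟩
    obtain ⟨φ, hφ⟩ := exists_isCharCocycle hS P.D
    have hmk := (mk_quotient_out (HH2.mk φ)).symm
    have hsub : P.S ⊆ phiInf (Quotient.out (HH2.mk φ)) :=
      (hφ.subset_phiInf P.isDG).trans (phiInf_eq hmk).subset
    have hiso := iso_restrict_embrPartial hmk hφ.curvedIso_spanLift
      (fun C => Classical.choose C.2) (fun C => Classical.choose_spec C.2) hsub
    -- Reconstruction embeds `P` in the deformation attached to its class, and maximality of `P`
    -- forces the two sets of objects to agree.
    have hPS := hP (embrPartial _ (fun C => Classical.choose C.2)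
      (fun C => Classical.choose_spec C.2)) ⟨hsub, hiso⟩
    exact ⟨HH2.mk φ, (Quot.sound ⟨hPS.symm, hiso⟩ : PartialDG.SkMax.mk P hP = _).symm⟩

theorem pcomSpan_iso_realization (φ : Z2 k a)
    (Γ : ∀ C : Precomplex a, {C' : Precomplex (DefCat φ) // C'.red = C}) :
    (pcomSpan φ Γ).Iso (realization φ) := by
  obtain ⟨δ, hδ⟩ : ∃ δ, pcomSpan φ Γ = spanLift φ id δ := spanDeformation_eq_spanLift _ _ _
  -- The cocycle stays the same here, so any `g` with `d g = 0` will do; only the lifts change.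
  obtain ⟨g, hg⟩ := HH2.mk_eq_mk_iff.1 (rfl : HH2.mk φ = HH2.mk φ)
  have h₁ : (pcomSpan φ Γ).CurvedIso (pcomTriv φ) := by
    rw [hδ]
    exact spanLift_curvedIso hg (id : Precomplex a → Precomplex a) δ fun _ => 0
  exact (h₁.trans (realization_coincide φ).symm.curvedIso).iso

end Maximal
end LowenDef

theorem mainTheorem6 {k : Type w} [Field k] {a : Type u} [Category.{v} a] [Preadditive a]
    [Linear k a] :
    (∀ φ : Z2 k a,
      ((realization φ).Coincide (pcomTriv φ) ∧ (realization φ).Iso (pcomTriv φ)) ∧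
      (∀ Γ : ∀ C : Precomplex a, {C' : Precomplex (DefCat φ) // C'.red = C},
        (pcomSpan φ Γ).Iso (realization φ)) ∧
      (∀ Γ : ∀ C : phiInf φ,
          {C' : Precomplex (DefCat φ) // C'.red = C.1.pre ∧ C'.IsComplex},
        (comSpan φ Γ).IsMaximal ∧ PartialDG.Sk.mk (comSpan φ Γ) = rhoPrime (HH2.mk φ))) ∧
    ∃ ρ : HH2 k a → PartialDG.SkMax (comPlus k a),
      (∀ x : HH2 k a, (ρ x).forget = rhoPrime x) ∧
      ∀ (Z : a) (hZ : Limits.IsZero Z),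
        Function.Injective ρ ∧
        Set.range ρ = {ξ | ∃ (P : PartialDG (comPlus k a)) (hP : P.IsMaximal),
          (∀ A : a, stalk A Z hZ ∈ P.S) ∧ PartialDG.SkMax.mk P hP = ξ} :=
  ⟨fun φ => ⟨⟨realization_coincide φ, (realization_coincide φ).curvedIso.iso⟩,
    pcomSpan_iso_realization φ, fun Γ => ⟨comSpan_isMaximal φ Γ, mk_comSpan φ Γ⟩⟩,
    rhoMax, fun _ => rfl, fun Z hZ => ⟨rhoMax_injective Z hZ, range_rhoMax Z hZ⟩⟩
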